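/- **Setting.** Let $V,H$ be real separable Hilbert spaces with a continuous, injective, dense embedding $V\hookrightarrow H$, giving the Gelfand triple $V\hookrightarrow H\simeq H'\hookrightarrow V'$. Let $T>0$, $I=(0,T)$, and let $a(t;\cdot,\cdot)$, $t\in I$, be bilinear forms on $V$ such that $t\mapsto a(t;\eta,\zeta)$ is measurable for all $\eta,\zeta\in V$ and, for some constants $M<\infty$, $c>0$ and almost every $t\in I$, $|a(t;\eta,\zeta)|\le M\|\eta\|_V\|\zeta\|_V$ and $a(t;\eta,\eta)\ge c\|\eta\|_V^2$ for all $\eta,\zeta\in V$. Put $Y=L_2(I;V)$ and $X=L_2(I;V)\cap H^1(I;V')$, let $\gamma_t w=w(t)\in H$ for $w\in X$, $t\in\{0,T\}$, and define $$(Aw)(v)=\int_I a(t;w(t),v(t))\,dt,\quad A_s=\tfrac12(A+A'),\quad A_a=\tfrac12(A-A'),\quad (\partial_t w)(v)=\int_I\langle \tfrac{dw}{dt}(t),v(t)\rangle\,dt,$$ $B=\partial_t+A$ and $C=\partial_t+A_a$ (both $X\to Y'$). Equip $Y$ with the norm $\|v\|_Y=\sqrt{(A_sv)(v)}$, its subspaces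 with the same norm, and the duals of $Y$ and of its subspaces with the resulting dual norms. Fix $\beta\ge1$ and put $|||w|||_X=\sqrt{\|Bw\|_{Y'}^2+\beta\|\gamma_0w\|_H^2}$ on $X$. Let $(X^\delta,Y^\delta)_{\delta\in\Delta}$ be a family of closed non-zero subspaces of $X$ and $Y$, respectively, with trivial embeddings $E_X^\delta,E_Y^\delta$, and let $$\gamma_\Delta^C=\inf_{\delta\in\Delta}\ \inf_{\{w\in X^\delta:\,CE_X^\delta w\ne0\}}\frac{\|{E_Y^\delta}'CE_X^\delta w\|_{{Y^\delta}'}}{\|CE_X^\delta w\|_{Y'}},$$ the infimum being taken in $[0,1]$, which contains all the quotients (so it is $1$ if there are none). Assume $\gamma_\Delta^C>0$. Let $g\in Y'$, $u_0\in H$, and let $u\in X$ solve $Bu=g$, $\gamma_0u=u_0$. **Theorem (robust bounds in the energy norm).** (i) (MR) Assume $X^\delta\subseteq Y^\delta$ for all $\delta\in\Delta$, and let $K_Y^\delta={K_Y^\delta}'$ be boundedly invertible linear maps ${Y^\delta}'\to Y^\delta$ such that, for constants $0<r_\Delta\le R_\Delta<\infty$, $$\frac{((K_Y^\delta)^{-1}v)(v)}{(A_sv)(v)}\in[r_\Delta,R_\Delta]\qquad(\delta\in\Delta,\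 0\ne v\in Y^\delta).$$ Then for each $\delta\in\Delta$ there is a unique $u^\delta\in X^\delta$ with $$\big({E_X^\delta}'B'E_Y^\delta K_Y^\delta{E_Y^\delta}'BE_X^\delta+\beta{E_X^\delta}'\gamma_0'\gamma_0E_X^\delta\big)u^\delta={E_X^\delta}'B'E_Y^\delta K_Y^\delta{E_Y^\delta}'g+\beta{E_X^\delta}'\gamma_0'u_0,$$ and it satisfies $$|||u-u^\delta|||_X\le\sqrt{\frac{\max(R_\Delta,1)}{\min(r_\Delta,1)}}\,(\gamma_\Delta^C)^{-1}\inf_{w\in X^\delta}|||u-w|||_X .$$ (ii) (BEN) Without assuming $X^\delta\subseteq Y^\delta$, for each $\delta\in\Delta$ there is a unique $\bar u^\delta\in X^\delta$ with $${E_X^\delta}'\big(C'E_Y^\delta S^\delta{E_Y^\delta}'C+A_s+\gamma_T'\gamma_T+(\beta-1)\gamma_0'\gamma_0\big)E_X^\delta\bar u^\delta={E_X^\delta}'\big(C'E_Y^\delta S^\delta{E_Y^\delta}'g+g+\beta\gamma_0'u_0\big),$$ where $S^\delta=({E_Y^\delta}'A_sE_Y^\delta)^{-1}$, and it satisfies $$|||u-\bar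 u^\delta|||_X\le(\gamma_\Delta^C)^{-2}\Big\{\inf_{w\in X^\delta}|||u-w|||_X+\inf_{v\in Y^\delta}\|u-v\|_Y\Big\}.$$ In particular, neither bound depends on $\alpha=\|A_a\|_{\mathcal L(Y,Y')}$ other than through $\gamma_\Delta^C$ (and, for MR, $r_\Delta,R_\Delta$). -/

import Mathlib

open MeasureTheory Set Filter Topology
open scoped ContDiff RealInnerProductSpace

noncomputable section

/-- Lebesgue measure on the time interval `I = (0, T)`. -/
abbrev timeMeasure (T : ℝ) : Measure ℝ := volume.restrict (Ioo 0 T)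

/-- `Y = L₂(I; V)`. -/
abbrev SpaceY (V : Type*) [NormedAddCommGroup V] (T : ℝ) : Type _ :=
  Lp V 2 (timeMeasure T)

/-- `L₂(I; V')`, with `V'` the topological dual of `V`. -/
abbrev SpaceDualValued (V : Type*) [NormedAddCommGroup V] [NormedSpace ℝ V] (T : ℝ) : Type _ :=
  Lp (StrongDual ℝ V) 2 (timeMeasure T)

/-- Substituting a simple function into a parameter preserves a.e.-measurability. -/
theorem aemeasurable_simple_subst {E : Type*} {μ : Measure ℝ} (s : SimpleFunc ℝ E)
    (g : E → ℝ → ℝ)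
    (hg : ∀ x, AEMeasurable (g x) μ) : AEMeasurable (fun t => g (s t) t) μ := by
  refine ⟨fun t => (hg (s t)).mk (g (s t)) t,
    s.measurable_bind (fun x t => (hg x).mk (g x) t) (fun x => (hg x).measurable_mk), ?_⟩
  have h : ∀ᵐ t ∂μ, ∀ x ∈ s.range, g x t = (hg x).mk (g x) t :=
    (Finset.eventually_all s.range).2 fun x _ => (hg x).ae_eq_mk
  filter_upwards [h] with t ht using ht (s t) (s.mem_range_self t)

/-- The product of the pointwise norms of two elements of `L₂(I; V)` is integrable. -/
theorem integrable_norm_mul {V : Type*} [NormedAddCommGroup V] {T : ℝ} (w v : SpaceY V T) :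
    Integrable (fun t => ‖w t‖ * ‖v t‖) (timeMeasure T) :=
  (Lp.memLp w).norm.integrable_mul (Lp.memLp v).norm

theorem integral_norm_mul_le {V : Type*} [NormedAddCommGroup V] {T : ℝ} (w v : SpaceY V T) :
    ∫ t, ‖w t‖ * ‖v t‖ ∂(timeMeasure T) ≤ ‖w‖ * ‖v‖ := by
  have hw := (Lp.memLp w).norm
  have hv := (Lp.memLp v).norm
  have h := real_inner_le_norm (hv.toLp _) (hw.toLp _)
  rw [L2.inner_def, Lp.norm_toLp, Lp.norm_toLp, eLpNorm_norm, eLpNorm_norm, ← Lp.norm_def,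
    ← Lp.norm_def, mul_comm ‖v‖] at h
  refine le_trans (le_of_eq (integral_congr_ae ?_)) h
  filter_upwards [hw.coeFn_toLp, hv.coeFn_toLp] with t h1 h2
  rw [h1, h2]
  simp

/-- Substituting a strongly measurable function into a parameter, in which the dependence is
continuous, preserves a.e.-measurability. -/
theorem aemeasurable_subst {E : Type*} [NormedAddCommGroup E] {μ : Measure ℝ} {v : ℝ → E}
    (hv : AEStronglyMeasurable v μ) (g : E → ℝ → ℝ) (hg : ∀ x, AEMeasurable (g x) μ)
    (hc : ∀ᵐ t ∂μ, Continuous fun x => g x t) : AEMeasurable (fun t => g (v t) t) μ := by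
  have h1 : AEMeasurable (fun t => g (hv.mk v t) t) μ := by
    refine aemeasurable_of_tendsto_metrizable_ae atTop
      (fun n => aemeasurable_simple_subst (hv.stronglyMeasurable_mk.approx n) g hg) ?_
    filter_upwards [hc] with t ht
    exact (ht.tendsto _).comp (hv.stronglyMeasurable_mk.tendsto_approx t)
  refine h1.congr ?_
  filter_upwards [hv.ae_eq_mk] with t ht
  rw [ht]

section Form

variable {V : Type*} [NormedAddCommGroup V] [InnerProductSpace ℝ V] {T : ℝ}

/-- A family `a(t; ·, ·)` of bilinear forms on `V` that is (weakly) measurable in `t`, and bounded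
and coercive uniformly in almost every `t ∈ I`. -/
structure ParabolicForm (V : Type*) [NormedAddCommGroup V] [InnerProductSpace ℝ V] (T : ℝ) where
  form : ℝ → V →ₗ[ℝ] V →ₗ[ℝ] ℝ
  aemeasurable : ∀ η ζ : V, AEMeasurable (fun t => form t η ζ) (timeMeasure T)
  bounded : ∃ M : ℝ, ∀ᵐ t ∂(timeMeasure T), ∀ η ζ : V, |form t η ζ| ≤ M * ‖η‖ * ‖ζ‖
  coercive : ∃ c : ℝ, 0 < c ∧ ∀ᵐ t ∂(timeMeasure T), ∀ η : V, c * ‖η‖ ^ 2 ≤ form t η η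

theorem continuous_of_abs_le {f : V →ₗ[ℝ] ℝ} {M : ℝ} (h : ∀ x, |f x| ≤ M * ‖x‖) :
    Continuous f :=
  (f.mkContinuous M h).continuous

namespace ParabolicForm

variable (a : ParabolicForm V T)

theorem aemeasurable_comp (w v : SpaceY V T) :
    AEMeasurable (fun t => a.form t (w t) (v t)) (timeMeasure T) := by
  obtain ⟨M, hM⟩ := a.bounded
  refine aemeasurable_subst (Lp.aestronglyMeasurable v) (fun x t => a.form t (w t) x)
    (fun ζ => ?_) ?_
  · refine aemeasurable_subst (Lp.aestronglyMeasurable w) (fun x t => a.form t x ζ)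
      (fun η => a.aemeasurable η ζ) ?_
    filter_upwards [hM] with t ht
    refine continuous_of_abs_le (f := (a.form t).flip ζ) (M := M * ‖ζ‖) fun x => ?_
    have := ht x ζ
    simp only [LinearMap.flip_apply]
    linarith [mul_right_comm M ‖x‖ ‖ζ‖]
  · filter_upwards [hM] with t ht
    exact continuous_of_abs_le (f := a.form t (w t)) (M := M * ‖w t‖) fun x => ht (w t) x

theorem integrable_comp (w v : SpaceY V T) :
    Integrable (fun t => a.form t (w t) (v t)) (timeMeasure T) := by
  obtain ⟨M, hM⟩ := a.bounded
  refine ((integrable_norm_mul w v).const_mul M).mono'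
    (a.aemeasurable_comp w v).aestronglyMeasurable ?_
  filter_upwards [hM] with t ht
  rw [Real.norm_eq_abs, ← mul_assoc]
  exact ht _ _

theorem exists_bound : ∃ M : ℝ, ∀ w v : SpaceY V T,
    ‖∫ t, a.form t (w t) (v t) ∂(timeMeasure T)‖ ≤ M * ‖w‖ * ‖v‖ := by
  obtain ⟨M, hM⟩ := a.bounded
  refine ⟨|M|, fun w v => ?_⟩
  calc ‖∫ t, a.form t (w t) (v t) ∂(timeMeasure T)‖
      ≤ ∫ t, |M| * (‖w t‖ * ‖v t‖) ∂(timeMeasure T) := by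
        refine norm_integral_le_of_norm_le ((integrable_norm_mul w v).const_mul |M|) ?_
        filter_upwards [hM] with t ht
        rw [Real.norm_eq_abs]
        refine (ht _ _).trans ?_
        rw [mul_assoc]
        exact mul_le_mul_of_nonneg_right (le_abs_self M) (by positivity)
    _ ≤ |M| * ‖w‖ * ‖v‖ := by
        rw [integral_const_mul, mul_assoc]
        exact mul_le_mul_of_nonneg_left (integral_norm_mul_le w v) (abs_nonneg M)

/-- The bilinear form `(w, v) ↦ ∫_I a(t; w(t), v(t)) dt` on `Y`. -/
def bilin : SpaceY V T →ₗ[ℝ] SpaceY V T →ₗ[ℝ] ℝ :=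
  LinearMap.mk₂ ℝ (fun w v => ∫ t, a.form t (w t) (v t) ∂(timeMeasure T))
    (fun w₁ w₂ v => by
      rw [← integral_add (a.integrable_comp w₁ v) (a.integrable_comp w₂ v)]
      refine integral_congr_ae ?_
      filter_upwards [Lp.coeFn_add w₁ w₂] with t ht
      rw [ht, Pi.add_apply]
      simp)
    (fun c w v => by
      rw [smul_eq_mul, ← integral_const_mul]
      refine integral_congr_ae ?_
      filter_upwards [Lp.coeFn_smul c w] with t ht
      rw [ht, Pi.smul_apply]
      simp)
    (fun w v₁ v₂ => by
      rw [← integral_add (a.integrable_comp w v₁) (a.integrable_comp w v₂)]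
      refine integral_congr_ae ?_
      filter_upwards [Lp.coeFn_add v₁ v₂] with t ht
      rw [ht, Pi.add_apply]
      simp)
    (fun c w v => by
      rw [smul_eq_mul, ← integral_const_mul]
      refine integral_congr_ae ?_
      filter_upwards [Lp.coeFn_smul c v] with t ht
      rw [ht, Pi.smul_apply]
      simp)

/-- `A : Y → Y'`, `(A w)(v) = ∫_I a(t; w(t), v(t)) dt`. -/
def opA : SpaceY V T →L[ℝ] StrongDual ℝ (SpaceY V T) :=
  a.bilin.mkContinuous₂ a.exists_bound.choose a.exists_bound.choose_spec

theorem opA_apply (w v : SpaceY V T) :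
    a.opA w v = ∫ t, a.form t (w t) (v t) ∂(timeMeasure T) := rfl

/-- The symmetric part `A_s = (A + A') / 2`. -/
def opAs : SpaceY V T →L[ℝ] StrongDual ℝ (SpaceY V T) :=
  (2⁻¹ : ℝ) • (a.opA + a.opA.flip)

/-- The antisymmetric part `A_a = (A - A') / 2`. -/
def opAa : SpaceY V T →L[ℝ] StrongDual ℝ (SpaceY V T) :=
  (2⁻¹ : ℝ) • (a.opA - a.opA.flip)

/-- The energy norm `‖v‖_Y = √((A_s v)(v))` on `Y`. -/
def normY (v : SpaceY V T) : ℝ := √(a.opAs v v)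

/-- The norm `sup_{0 ≠ v ∈ F} |f(v)| / ‖v‖_Y` on the dual of a subspace `F ⊆ Y`, where `F` is
equipped with the energy norm (`v = 0` contributes the value `0`). -/
def dualNorm (F : Submodule ℝ (SpaceY V T)) (f : StrongDual ℝ F) : ℝ :=
  ⨆ v : F, |f v| / a.normY (v : SpaceY V T)

end ParabolicForm

/-- `E_Y' : Y' → F'`, the dual of the trivial embedding of `F ⊆ Y`. -/
def restrictDual (F : Submodule ℝ (SpaceY V T)) (f : StrongDual ℝ (SpaceY V T)) :
    StrongDual ℝ F :=
  f.comp F.subtypeL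

/-- The norm on `Y'` dual to the energy norm on `Y`. -/
def ParabolicForm.normYDual (a : ParabolicForm V T) (f : StrongDual ℝ (SpaceY V T)) : ℝ :=
  ⨆ v : SpaceY V T, |f v| / a.normY v

/-- The operator `E_Y' A_s E_Y : F → F'` for a subspace `F ⊆ Y`. -/
def ParabolicForm.opAsOn (a : ParabolicForm V T) (F : Submodule ℝ (SpaceY V T)) :
    F →L[ℝ] StrongDual ℝ F :=
  a.opAs.bilinearComp F.subtypeL F.subtypeL

end Form

section Trial

variable {V H : Type*} [NormedAddCommGroup V] [InnerProductSpace ℝ V]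
  [NormedAddCommGroup H] [InnerProductSpace ℝ H]

/-- With `j : V → H` the embedding of the Gelfand triple `V ↪ H ≃ H' ↪ V'`, the function
`f ∈ L₂(I; V')` is the weak time derivative of `w ∈ L₂(I; V)`. -/
def HasWeakTimeDeriv (j : V →L[ℝ] H) {T : ℝ} (w : SpaceY V T) (f : SpaceDualValued V T) : Prop :=
  ∀ φ : ℝ → ℝ, ContDiff ℝ ∞ φ → HasCompactSupport φ → tsupport φ ⊆ Ioo 0 T → ∀ v : V,
    ∫ t, deriv φ t * ⟪j (w t), j v⟫ ∂(timeMeasure T) = -∫ t, φ t * f t v ∂(timeMeasure T)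

theorem integrable_mul_of_memLp_two {T : ℝ} {φ g : ℝ → ℝ} (hφ : Continuous φ)
    (hs : HasCompactSupport φ) (hg : MemLp g 2 (timeMeasure T)) :
    Integrable (fun t => φ t * g t) (timeMeasure T) := by
  obtain ⟨K, hK⟩ := hs.exists_bound_of_continuous hφ
  exact (hg.integrable (by norm_num)).bdd_mul hφ.aestronglyMeasurable
    (Eventually.of_forall hK)

theorem memLp_inner_embed (j : V →L[ℝ] H) {T : ℝ} (w : SpaceY V T) (v : V) :
    MemLp (fun t => ⟪j (w t), j v⟫) 2 (timeMeasure T) :=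
  ((Lp.memLp w).continuousLinearMap_comp j).inner_const (j v)

theorem memLp_dual_apply {T : ℝ} (f : SpaceDualValued V T) (v : V) :
    MemLp (fun t => f t v) 2 (timeMeasure T) :=
  (Lp.memLp f).continuousLinearMap_comp (ContinuousLinearMap.apply ℝ ℝ v)

/-- `X = L₂(I; V) ∩ H¹(I; V')`, realized as the space of pairs `(w, ∂_t w)` in
`L₂(I; V) × L₂(I; V')`. The topology it inherits from the product is that of the usual norm
of `X`. -/
def SpaceX (j : V →L[ℝ] H) (T : ℝ) : Submodule ℝ (SpaceY V T × SpaceDualValued V T) where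
  carrier := {p | HasWeakTimeDeriv j p.1 p.2}
  zero_mem' := by
    intro φ _ _ _ v
    have h1 : ∫ t, deriv φ t * ⟪j ((0 : SpaceY V T) t), j v⟫ ∂(timeMeasure T)
        = ∫ _, (0 : ℝ) ∂(timeMeasure T) := by
      refine integral_congr_ae ?_
      filter_upwards [Lp.coeFn_zero V 2 (timeMeasure T)] with t ht
      rw [ht]
      simp
    have h2 : ∫ t, φ t * (0 : SpaceDualValued V T) t v ∂(timeMeasure T)
        = ∫ _, (0 : ℝ) ∂(timeMeasure T) := by
      refine integral_congr_ae ?_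
      filter_upwards [Lp.coeFn_zero (StrongDual ℝ V) 2 (timeMeasure T)] with t ht
      rw [ht]
      simp
    simp only [Prod.fst_zero, Prod.snd_zero]
    rw [h1, h2]
    simp
  add_mem' := by
    rintro ⟨w₁, f₁⟩ ⟨w₂, f₂⟩ h₁ h₂ φ hφ hs ht v
    have hd : Continuous (deriv φ) := hφ.continuous_deriv (by simp)
    have e1 : ∫ t, deriv φ t * ⟪j ((w₁ + w₂ : SpaceY V T) t), j v⟫ ∂(timeMeasure T)
        = ∫ t, (deriv φ t * ⟪j (w₁ t), j v⟫ + deriv φ t * ⟪j (w₂ t), j v⟫)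
          ∂(timeMeasure T) := by
      refine integral_congr_ae ?_
      filter_upwards [Lp.coeFn_add w₁ w₂] with t ht
      rw [ht, Pi.add_apply, map_add, inner_add_left, mul_add]
    have e2 : ∫ t, φ t * (f₁ + f₂ : SpaceDualValued V T) t v ∂(timeMeasure T)
        = ∫ t, (φ t * f₁ t v + φ t * f₂ t v) ∂(timeMeasure T) := by
      refine integral_congr_ae ?_
      filter_upwards [Lp.coeFn_add f₁ f₂] with t ht
      rw [ht, Pi.add_apply, add_apply, mul_add]
    have := h₁ φ hφ hs ht v
    have := h₂ φ hφ hs ht v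
    simp only [Prod.mk_add_mk] at *
    rw [e1, e2, integral_add (integrable_mul_of_memLp_two hd hs.deriv (memLp_inner_embed j w₁ v))
        (integrable_mul_of_memLp_two hd hs.deriv (memLp_inner_embed j w₂ v)),
      integral_add (integrable_mul_of_memLp_two hφ.continuous hs (memLp_dual_apply f₁ v))
        (integrable_mul_of_memLp_two hφ.continuous hs (memLp_dual_apply f₂ v))]
    linarith
  smul_mem' := by
    rintro c ⟨w, f⟩ h φ hφ hs ht v
    have e1 : ∫ t, deriv φ t * ⟪j ((c • w : SpaceY V T) t), j v⟫ ∂(timeMeasure T)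
        = ∫ t, c * (deriv φ t * ⟪j (w t), j v⟫) ∂(timeMeasure T) := by
      refine integral_congr_ae ?_
      filter_upwards [Lp.coeFn_smul c w] with t ht
      rw [ht, Pi.smul_apply, map_smul, real_inner_smul_left, mul_left_comm]
    have e2 : ∫ t, φ t * (c • f : SpaceDualValued V T) t v ∂(timeMeasure T)
        = ∫ t, c * (φ t * f t v) ∂(timeMeasure T) := by
      refine integral_congr_ae ?_
      filter_upwards [Lp.coeFn_smul c f] with t ht
      rw [ht, Pi.smul_apply, smul_apply, smul_eq_mul, mul_left_comm]
    have := h φ hφ hs ht v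
    simp only [Prod.smul_mk] at *
    rw [e1, e2, integral_const_mul, integral_const_mul, this]
    ring

variable {j : V →L[ℝ] H} {T : ℝ}

/-- The embedding `X ↪ Y`. -/
def embY : SpaceX j T →L[ℝ] SpaceY V T :=
  (ContinuousLinearMap.fst ℝ _ _).comp (SpaceX j T).subtypeL

/-- The weak time derivative of an element of `X`, as an element of `L₂(I; V')`. -/
def weakDt : SpaceX j T →L[ℝ] SpaceDualValued V T :=
  (ContinuousLinearMap.snd ℝ _ _).comp (SpaceX j T).subtypeL

open Classical in
/-- The trace `γ_t w = w(t) ∈ H`, for `t ∈ [0, T]`: the value at `t` of the representative of `w`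
in `C([0, T]; H)`. -/
def trace (t : ℝ) (w : SpaceX j T) : H :=
  if h : ∃ W : ℝ → H, ContinuousOn W (Icc 0 T) ∧
      (fun s => j (embY w s)) =ᵐ[timeMeasure T] W
  then h.choose t else 0

/-- `∂_t : X → Y'`, `(∂_t w)(v) = ∫_I ⟨(dw/dt)(t), v(t)⟩ dt`. -/
def opDt : SpaceX j T →L[ℝ] StrongDual ℝ (SpaceY V T) :=
  ((ContinuousLinearMap.id ℝ (StrongDual ℝ V)).lpPairing (timeMeasure T) 2 2).comp weakDt

theorem opDt_apply (w : SpaceX j T) (v : SpaceY V T) :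
    opDt w v = ∫ t, weakDt w t (v t) ∂(timeMeasure T) := by
  simp [opDt, ContinuousLinearMap.lpPairing_eq_integral]

namespace ParabolicForm

variable (a : ParabolicForm V T)

/-- `B = ∂_t + A : X → Y'`. -/
def opB : SpaceX j T →L[ℝ] StrongDual ℝ (SpaceY V T) := opDt + a.opA.comp embY

/-- `C = B - A_s = ∂_t + A_a : X → Y'`. -/
def opC : SpaceX j T →L[ℝ] StrongDual ℝ (SpaceY V T) := opDt + a.opAa.comp embY

/-- The energy norm `|||w|||_X = √(‖B w‖_{Y'}² + β ‖γ_0 w‖²)` on `X`. -/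
def energyNormX (β : ℝ) (w : SpaceX j T) : ℝ :=
  √(a.normYDual (a.opB w) ^ 2 + β * ‖trace 0 w‖ ^ 2)

/-- The inf-sup constant
`γ_Δ^C = inf_δ inf_{w ∈ X^δ, C w ≠ 0} ‖E_Y' C w‖_{(Y^δ)'} / ‖C w‖_{Y'}`.
All these quotients lie in `[0, 1]`, and the infimum is taken in `[0, 1]`: including the value `1`
has no effect, except that the infimum of the empty set (all `C w` vanish) is `1`. -/
def gammaC {Δ : Type*} (Xd : Δ → Submodule ℝ (SpaceX j T))
    (Yd : Δ → Submodule ℝ (SpaceY V T)) : ℝ :=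
  sInf (insert 1 {q : ℝ | ∃ δ : Δ, ∃ w ∈ Xd δ, a.opC w ≠ 0 ∧
    q = a.dualNorm (Yd δ) (restrictDual (Yd δ) (a.opC w)) / a.normYDual (a.opC w)})

/-- `uδ ∈ X^δ` solves the minimal residual system
`(E_X' B' E_Y K E_Y' B E_X + β E_X' γ_0' γ_0 E_X) uδ = E_X' B' E_Y K E_Y' g + β E_X' γ_0' u₀`. -/
def IsMRSolution (β : ℝ) (Xd : Submodule ℝ (SpaceX j T)) (Yd : Submodule ℝ (SpaceY V T))
    (K : StrongDual ℝ Yd ≃L[ℝ] Yd) (g : StrongDual ℝ (SpaceY V T)) (u₀ : H)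
    (uδ : SpaceX j T) : Prop :=
  uδ ∈ Xd ∧ ∀ z ∈ Xd,
    a.opB z (K (restrictDual Yd (a.opB uδ)) : SpaceY V T) + β * ⟪trace 0 uδ, trace 0 z⟫
      = a.opB z (K (restrictDual Yd g) : SpaceY V T) + β * ⟪u₀, trace 0 z⟫

/-- `uδ ∈ X^δ` solves the Brézis-Ekeland-Nayroles system
`E_X' (C' E_Y S E_Y' C + A_s + γ_T' γ_T + (β - 1) γ_0' γ_0) E_X uδ
  = E_X' (C' E_Y S E_Y' g + g + β γ_0' u₀)` with `S = (E_Y' A_s E_Y)⁻¹`. -/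
def IsBENSolution (β : ℝ) (Xd : Submodule ℝ (SpaceX j T)) (Yd : Submodule ℝ (SpaceY V T))
    (g : StrongDual ℝ (SpaceY V T)) (u₀ : H) (uδ : SpaceX j T) : Prop :=
  uδ ∈ Xd ∧ ∀ z ∈ Xd,
    a.opC z ((a.opAsOn Yd).inverse (restrictDual Yd (a.opC uδ)) : SpaceY V T)
        + a.opAs (embY uδ) (embY z) + ⟪trace T uδ, trace T z⟫
        + (β - 1) * ⟪trace 0 uδ, trace 0 z⟫
      = a.opC z ((a.opAsOn Yd).inverse (restrictDual Yd g) : SpaceY V T)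
        + g (embY z) + β * ⟪u₀, trace 0 z⟫

end ParabolicForm

end Trial

end

/-!
Both methods are Galerkin methods on `X^δ` whose bilinear form is compared with the inner product
`s` of the energy norm, `s(w, w) = |||w|||_X²`. All constants come from two facts.

*An identity for the energy norm.* Since `B = C + A_s`, expanding the dual norm gives `‖B w‖²_{Y'}
= ‖C w‖²_{Y'} + 2 (C w)(w) + ‖w‖_Y²` (`IsSymmCoercive.inverse_add`), and integration by parts in
time gives `2 (C w)(w) = ‖γ_T w‖² - ‖γ_0 w‖²` because `A_a` is skew-symmetric. Hence `|||w|||_X² =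
‖C w‖²_{Y'} + ‖w‖_Y² + ‖γ_T w‖² + (β - 1) ‖γ_0 w‖²` (`ParabolicForm.energyForm_self_eq`). Replacing
`‖C w‖_{Y'}` by the discrete dual norm yields the form `b` of the Brézis-Ekeland-Nayroles system,
so that `b ≤ s` on `X` and, as `γ_Δ^C ≤ 1`, `(γ_Δ^C)² s ≤ b` on `X^δ`. If `X^δ ⊆ Y^δ`, the same
expansion in `(Y^δ)'` shows that on `X^δ` it is the minimal residual form with the exact Riesz map; a
preconditioner `K_Y^δ` changes that form by factors between `1 / max(R, 1)` and `1 / min(r, 1)`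
(`IsSymmCoercive.compare_inverse`).

*Quasi-optimality without the additive `1`.* If `b ≤ s`, `b ≥ κ s` on the trial space, and `e` is
`b`-orthogonal to `z`, then `s(e, z) = (s - b)(e, z)`, and the Cauchy-Schwarz inequality for the
semidefinite form `s - b` gives `κ s(e, e) ≤ s(e - z, e - z)` (`galerkin_quasi_optimal`). For the
minimal residual method this is the claim. The load of the Brézis-Ekeland-Nayroles system differs
from `b(u, ·)` by `(C ·)(u - P u)`, with `P` the projection onto `Y^δ` in the energy norm, which
contributes the second infimum (`ParabolicForm.ben_load_eq`, `galerkin_error_le_of_consistency`).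

Well-posedness uses that `X` is complete, that the traces are bounded, and that `|||·|||_X`
dominates the norm of `X`. The analytic ingredient is the existence of traces. With `V'` identified
with `V` by the Riesz map, the embedding `V ↪ V'` becomes `K = j* j`, and a weak derivative `F` of
`w` means that `K w` has the absolutely continuous representative `Z(t) = z₀ + ∫₀ᵗ F`. Regularizing
in space rather than in time avoids extending `w` beyond `(0, T)`: the resolvents `R_n = (K +
ε_n)⁻¹` turn `Z` into continuous `V`-valued curves `R_n Z`, equal to `R_n K w` almost everywhere,
for which the energy identity is elementary. As `R_n K → 1` strongly, the curves `j R_n Z` converge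
uniformly in `H` to a continuous representative of `j w`, and the identity passes to the limit
(`exists_continuousOn_representative`).
-/

/-! ### Absolutely continuous primitives and the lemma of du Bois-Reymond -/

noncomputable section

/-- A curve whose increments are dominated by those of an absolutely continuous one is absolutely
continuous. -/
theorem AbsolutelyContinuousOnInterval.of_dist_le {X Y : Type*} [PseudoMetricSpace X]
    [PseudoMetricSpace Y] {f : ℝ → X} {h : ℝ → Y} {s t C : ℝ}
    (hh : AbsolutelyContinuousOnInterval h s t)
    (hf : ∀ x ∈ uIcc s t, ∀ y ∈ uIcc s t, dist (f x) (f y) ≤ C * dist (h x) (h y)) :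
    AbsolutelyContinuousOnInterval f s t := by
  have hC := Tendsto.const_mul C hh
  rw [mul_zero] at hC
  refine squeeze_zero' (Eventually.of_forall fun E => Finset.sum_nonneg fun i _ => dist_nonneg)
    ?_ hC
  refine eventually_inf_principal.mpr (Eventually.of_forall fun E hE => ?_)
  rw [Finset.mul_sum]
  exact Finset.sum_le_sum fun i hi => hf _ (hE.1 i hi).1 _ (hE.1 i hi).2

section Primitive

variable {E : Type*} [NormedAddCommGroup E] [InnerProductSpace ℝ E] [CompleteSpace E]

/-- The chain rule `‖y‖²' = 2⟨y, y'⟩`, integrated, for an absolutely continuous curve `y` given as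
a primitive of an integrable function. -/
theorem norm_sq_sub_norm_sq_eq_integral {T : ℝ} {G : ℝ → E} (hT : 0 ≤ T)
    (hG : IntervalIntegrable G volume 0 T) (y₀ : E) {s t : ℝ}
    (hs : s ∈ Icc 0 T) (ht : t ∈ Icc 0 T) :
    ‖y₀ + ∫ τ in (0 : ℝ)..t, G τ‖ ^ 2 - ‖y₀ + ∫ τ in (0 : ℝ)..s, G τ‖ ^ 2
      = ∫ σ in s..t, 2 * ⟪y₀ + ∫ τ in (0 : ℝ)..σ, G τ, G σ⟫ := by
  set y : ℝ → E := fun t => y₀ + ∫ τ in (0 : ℝ)..t, G τ with hy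
  have h0T : uIcc (0 : ℝ) T = Icc 0 T := uIcc_of_le hT
  have h0 : (0 : ℝ) ∈ uIcc 0 T := left_mem_uIcc
  have hI : ∀ x ∈ Icc 0 T, ∀ z ∈ Icc 0 T, IntervalIntegrable G volume x z := fun x hx z hz =>
    hG.mono_set (by rw [h0T]; exact uIcc_subset_Icc hx hz)
  have hcont : ContinuousOn y (uIcc 0 T) :=
    continuousOn_const.add (intervalIntegral.continuousOn_primitive_interval
      ((intervalIntegrable_iff_integrableOn_Icc_of_le hT).1 hG |>.mono_set (by rw [h0T])))
  obtain ⟨M, hM⟩ := isCompact_uIcc.exists_bound_of_continuousOn hcont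
  have hdist : ∀ x ∈ Icc 0 T, ∀ z ∈ Icc 0 T, dist (y x) (y z) ≤
      dist (∫ τ in (0 : ℝ)..x, ‖G τ‖) (∫ τ in (0 : ℝ)..z, ‖G τ‖) := by
    intro x hx z hz
    have hz0 := hI 0 (by simp [hT]) z hz
    have hx0 := hI 0 (by simp [hT]) x hx
    rw [dist_eq_norm, Real.dist_eq, intervalIntegral.integral_interval_sub_left hx0.norm hz0.norm]
    simp only [hy, add_sub_add_left_eq_sub]
    rw [intervalIntegral.integral_interval_sub_left hx0 hz0]
    exact intervalIntegral.norm_integral_le_abs_integral_norm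
  -- The increments of `‖y‖²` are dominated by those of `2 M ∫ ‖G‖`.
  have hac : AbsolutelyContinuousOnInterval (fun t => ‖y t‖ ^ 2) 0 T := by
    refine (hG.norm.absolutelyContinuousOnInterval_intervalIntegral h0).of_dist_le (C := 2 * M) ?_
    intro x hx z hz
    have hMx := hM x hx
    have hMz := hM z hz
    rw [h0T] at hx hz
    refine le_trans ?_ (mul_le_mul_of_nonneg_left (hdist x hx z hz)
      (by linarith [norm_nonneg (y x)]))
    rw [Real.dist_eq, dist_eq_norm, sq_sub_sq, abs_mul, abs_of_nonneg (by positivity)]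
    exact mul_le_mul (by linarith) (abs_norm_sub_norm_le _ _) (abs_nonneg _)
      (by linarith [norm_nonneg (y x)])
  have hst : uIcc s t ⊆ uIcc 0 T := by rw [h0T]; exact uIcc_subset_Icc hs ht
  rw [← (hac.mono hst).integral_deriv_eq_sub]
  refine intervalIntegral.integral_congr_ae ?_
  filter_upwards [hG.ae_hasDerivAt_integral] with x hx hxm
  have hd : HasDerivAt y (G x) x :=
    (hx (hst (uIoc_subset_uIcc hxm)) 0 h0).const_add y₀
  exact (hd.norm_sq).deriv

/-- A primitive has its integrand as weak derivative. -/
theorem integral_deriv_mul_primitive {T : ℝ} {G : ℝ → ℝ}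
    (hG : IntervalIntegrable G volume 0 T) {φ : ℝ → ℝ} (hφ : ContDiff ℝ ∞ φ)
    (hφ0 : φ 0 = 0) (hφT : φ T = 0) :
    ∫ t in (0 : ℝ)..T, deriv φ t * ∫ τ in (0 : ℝ)..t, G τ = -∫ t in (0 : ℝ)..T, φ t * G t := by
  have h0 : (0 : ℝ) ∈ uIcc 0 T := left_mem_uIcc
  have h1 := hG.absolutelyContinuousOnInterval_intervalIntegral h0
  have h2 : AbsolutelyContinuousOnInterval φ 0 T :=
    (hφ.of_le (by simp)).contDiffOn.absolutelyContinuousOnInterval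
  have h3 := h2.integral_mul_deriv_eq_deriv_mul h1
  have h4 : ∫ t in (0 : ℝ)..T, φ t * deriv (fun x => ∫ τ in (0 : ℝ)..x, G τ) t
      = ∫ t in (0 : ℝ)..T, φ t * G t := by
    refine intervalIntegral.integral_congr_ae ?_
    filter_upwards [hG.ae_hasDerivAt_integral] with x hx hxm
    rw [(hx (uIoc_subset_uIcc hxm) 0 h0).deriv]
  rw [h4, hφ0, hφT] at h3
  linarith

/-- The lemma of du Bois-Reymond: a function whose weak derivative vanishes is constant. -/
theorem exists_ae_eq_const_of_integral_deriv_smul_eq_zero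
    {E : Type*} [NormedAddCommGroup E] [NormedSpace ℝ E] [CompleteSpace E]
    {T : ℝ} (hT : 0 < T) {g : ℝ → E}
    (hg : IntegrableOn g (Ioo 0 T))
    (h : ∀ φ : ℝ → ℝ, ContDiff ℝ ∞ φ → HasCompactSupport φ → tsupport φ ⊆ Ioo 0 T →
      ∫ t in Ioo 0 T, deriv φ t • g t = 0) :
    ∃ c : E, ∀ᵐ t ∂(volume.restrict (Ioo 0 T)), g t = c := by
  let bump : ContDiffBump (T / 2) := ⟨T / 8, T / 4, by linarith, by linarith⟩
  set ρ : ℝ → ℝ := bump.normed volume with hρ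
  have hρs : ContDiff ℝ ∞ ρ := bump.contDiff_normed
  have hρc : HasCompactSupport ρ := bump.hasCompactSupport_normed
  have hρt : tsupport ρ = Metric.closedBall (T / 2) (T / 4) := bump.tsupport_normed_eq
  have hρ1 : ∫ t, ρ t = 1 := bump.integral_normed
  have hint : ∀ ψ : ℝ → ℝ, Continuous ψ → HasCompactSupport ψ →
      IntegrableOn (fun t => ψ t • g t) (Ioo 0 T) := by
    intro ψ hψ hψc
    obtain ⟨M, hM⟩ := hψc.exists_bound_of_continuous hψ
    exact hg.bdd_smul M hψ.aestronglyMeasurable (Eventually.of_forall hM)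
  set c : E := ∫ t in Ioo 0 T, ρ t • g t with hc
  refine ⟨c, ?_⟩
  have key : ∀ ψ : ℝ → ℝ, ContDiff ℝ ∞ ψ → HasCompactSupport ψ → tsupport ψ ⊆ Ioo 0 T →
      ∫ t in Ioo 0 T, ψ t • g t = (∫ t, ψ t) • c := by
    intro ψ hψ hψc hψt
    set m := ∫ t, ψ t with hm
    -- `θ` has mean zero, so its primitive `Φ` is an admissible test function.
    set θ : ℝ → ℝ := fun t => ψ t - m * ρ t with hθ
    have hθs : ContDiff ℝ ∞ θ := hψ.sub (contDiff_const.mul hρs)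
    set K := tsupport ψ ∪ tsupport ρ with hK
    have hKc : IsCompact K := hψc.isCompact.union hρc.isCompact
    have hKn : K.Nonempty := ⟨T / 2, Or.inr (by
      rw [hρt]; exact Metric.mem_closedBall_self (by linarith))⟩
    have hKI : K ⊆ Ioo 0 T := by
      refine union_subset hψt ?_
      rw [hρt, Real.closedBall_eq_Icc]
      intro x hx
      constructor <;> linarith [hx.1, hx.2]
    have ha := hKI (hKc.sInf_mem hKn)
    have hb := hKI (hKc.sSup_mem hKn)
    have hθ0 : ∀ t, t ∉ Icc (sInf K) (sSup K) → θ t = 0 := by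
      intro t ht
      have htK : t ∉ K := fun h => ht
        ⟨csInf_le hKc.bddBelow h, le_csSup hKc.bddAbove h⟩
      have h1 : ψ t = 0 := image_eq_zero_of_notMem_tsupport fun h => htK (Or.inl h)
      have h2 : ρ t = 0 := image_eq_zero_of_notMem_tsupport fun h => htK (Or.inr h)
      simp [hθ, h1, h2]
    have hθi : ∀ x y, IntervalIntegrable θ volume x y := fun x y =>
      hθs.continuous.intervalIntegrable x y
    have hψI : Integrable ψ := hψ.continuous.integrable_of_hasCompactSupport hψc
    have hρI : Integrable ρ := hρs.continuous.integrable_of_hasCompactSupport hρc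
    have hθ1 : ∫ t in (0 : ℝ)..T, θ t = 0 := by
      rw [intervalIntegral.integral_eq_integral_of_support_subset]
      · rw [integral_sub hψI (hρI.const_mul m), integral_const_mul, hρ1]
        simp [hm]
      · intro t ht
        by_contra hcon
        refine ht (hθ0 t fun h => hcon ⟨ha.1.trans_le h.1, h.2.trans hb.2.le⟩)
    set Φ : ℝ → ℝ := fun t => ∫ τ in (0 : ℝ)..t, θ τ with hΦ
    have hΦd : ∀ t, HasDerivAt Φ (θ t) t := fun t =>
      intervalIntegral.integral_hasDerivAt_right (hθi _ _)
        (hθs.continuous.stronglyMeasurableAtFilter _ _) hθs.continuous.continuousAt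
    have hΦ' : deriv Φ = θ := funext fun t => (hΦd t).deriv
    have hΦs : ContDiff ℝ ∞ Φ := by
      rw [contDiff_infty_iff_deriv, hΦ']
      exact ⟨fun t => (hΦd t).differentiableAt, hθs⟩
    have hΦ0 : Function.support Φ ⊆ Icc (sInf K) (sSup K) := by
      intro t ht
      by_contra hcon
      rcases lt_or_ge t (sInf K) with h1 | h1
      · refine ht ?_
        simp only [hΦ]
        rw [intervalIntegral.integral_congr (g := fun _ => (0 : ℝ))]
        · simp
        · intro x hx
          refine hθ0 x fun hx' => ?_
          have := hx.2
          have h3 := hx'.1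
          rcases le_max_iff.1 this with h4 | h4 <;> linarith [ha.1]
      · have h2 : sSup K < t := by
          by_contra h3
          exact hcon ⟨h1, not_lt.1 h3⟩
        refine ht ?_
        simp only [hΦ]
        rw [← intervalIntegral.integral_add_adjacent_intervals (hθi 0 T) (hθi T t), hθ1, zero_add,
          intervalIntegral.integral_congr (g := fun _ => (0 : ℝ))]
        · simp
        · intro x hx
          refine hθ0 x fun hx' => ?_
          have := hx.1
          have h3 := hx'.2
          rcases min_le_iff.1 this with h4 | h4 <;> linarith [hb.2]
    have hΦt : tsupport Φ ⊆ Icc (sInf K) (sSup K) := closure_minimal hΦ0 isClosed_Icc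
    have h0 := h Φ hΦs (isCompact_Icc.of_isClosed_subset (isClosed_tsupport _) hΦt)
      (hΦt.trans (Icc_subset_Ioo ha.1 hb.2))
    rw [hΦ'] at h0
    simp only [hθ, sub_smul, mul_smul] at h0
    rw [integral_sub (hint ψ hψ.continuous hψc) ((hint ρ hρs.continuous hρc).fun_smul m),
      integral_smul, sub_eq_zero] at h0
    exact h0
  have hgc : LocallyIntegrableOn (fun t => g t - c) (Ioo 0 T) :=
    (hg.sub (integrableOn_const (by simp))).locallyIntegrableOn
  have := isOpen_Ioo.ae_eq_zero_of_integral_contDiff_smul_eq_zero hgc fun ψ hψ hψc hψt => ?_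
  · rw [ae_restrict_iff' measurableSet_Ioo]
    filter_upwards [this] with t ht htm
    exact sub_eq_zero.1 (ht htm)
  · have hs : ∀ t, t ∉ Ioo 0 T → ψ t • (g t - c) = 0 := fun t ht => by
      rw [image_eq_zero_of_notMem_tsupport fun h => ht (hψt h), zero_smul]
    rw [← setIntegral_eq_integral_of_forall_compl_eq_zero hs]
    simp only [smul_sub]
    have hψI : Integrable ψ := hψ.continuous.integrable_of_hasCompactSupport hψc
    rw [integral_sub (hint ψ hψ.continuous hψc) (hψI.integrableOn.smul_const c), key ψ hψ hψc hψt,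
      integral_smul_const, setIntegral_eq_integral_of_forall_compl_eq_zero fun t ht =>
        image_eq_zero_of_notMem_tsupport fun h => ht (hψt h), sub_self]
end Primitive

end

/-! ### Resolvents of the embedding of the Gelfand triple -/

noncomputable section

section Resolvent

variable {V H : Type*} [NormedAddCommGroup V] [InnerProductSpace ℝ V] [CompleteSpace V]
  [NormedAddCommGroup H] [InnerProductSpace ℝ H] [CompleteSpace H]

/-- The operator `j* j` on `V`. Under the Riesz identification of `V'` with `V`, it is the embedding
`V ↪ H ≃ H' ↪ V'` of the Gelfand triple. -/
def gelfandOp (j : V →L[ℝ] H) : V →L[ℝ] V := (ContinuousLinearMap.adjoint j).comp j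

theorem inner_gelfandOp_left (j : V →L[ℝ] H) (x y : V) : ⟪gelfandOp j x, y⟫ = ⟪j x, j y⟫ :=
  ContinuousLinearMap.adjoint_inner_left j y (j x)

theorem inner_gelfandOp_right (j : V →L[ℝ] H) (x y : V) : ⟪x, gelfandOp j y⟫ = ⟪j x, j y⟫ :=
  ContinuousLinearMap.adjoint_inner_right j x (j y)

theorem exists_resolvent_gelfandOp (j : V →L[ℝ] H) {ε : ℝ} (hε : 0 < ε) :
    ∃ R : V →L[ℝ] V, (∀ x, gelfandOp j (R x) + ε • R x = x) ∧
      ∀ x, R (gelfandOp j x) = gelfandOp j (R x) := by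
  have hco : IsCoercive ((innerSL ℝ).comp (gelfandOp j + ε • ContinuousLinearMap.id ℝ V) :
      V →L[ℝ] V →L[ℝ] ℝ) := by
    refine ⟨ε, hε, fun x => ?_⟩
    simp only [ContinuousLinearMap.comp_apply, innerSL_apply_apply, add_apply, smul_apply,
      ContinuousLinearMap.id_apply, inner_add_left, real_inner_smul_left, inner_gelfandOp_left,
      real_inner_self_eq_norm_sq]
    nlinarith [sq_nonneg ‖j x‖]
  set e := hco.continuousLinearEquivOfBilin
  have he : ∀ x, e x = gelfandOp j x + ε • x := fun x => by
    refine ext_inner_right ℝ fun y => ?_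
    rw [hco.continuousLinearEquivOfBilin_apply]
    change ⟪gelfandOp j x + ε • x, y⟫ = _
    rfl
  refine ⟨e.symm, fun x => ?_, fun x => ?_⟩
  · rw [ContinuousLinearEquiv.coe_coe, ← he, e.apply_symm_apply]
  · rw [ContinuousLinearEquiv.coe_coe, ContinuousLinearEquiv.symm_apply_eq, he, ← map_smul,
      ← map_add, ← he, e.apply_symm_apply]

/-- The operator `j* j` is self-adjoint and injective. -/
theorem denseRange_gelfandOp {j : V →L[ℝ] H} (hj : Function.Injective j) :
    DenseRange (gelfandOp j) := by
  have h : (gelfandOp j).range.topologicalClosure = ⊤ := by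
    rw [Submodule.topologicalClosure_eq_top_iff, Submodule.eq_bot_iff]
    intro x hx
    have h1 := (Submodule.mem_orthogonal _ x).1 hx (gelfandOp j x) ⟨x, rfl⟩
    rw [inner_gelfandOp_left, inner_self_eq_zero] at h1
    exact hj (by rw [h1, map_zero])
  exact Submodule.dense_iff_topologicalClosure_eq_top.2 h

/-- Bounded operators `Rₙ = (j* j + εₙ)⁻¹`, `εₙ → 0`: the contractions `Rₙ j* j` commute with `j* j`
and converge strongly to the identity. In the Gelfand triple, `Rₙ` maps `V'` boundedly into `V`. -/
theorem exists_approximate_inverse_gelfandOp {j : V →L[ℝ] H} (hj : Function.Injective j) :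
    ∃ R : ℕ → V →L[ℝ] V, (∀ n x, R n (gelfandOp j x) = gelfandOp j (R n x)) ∧
      (∀ n x, ‖R n (gelfandOp j x)‖ ≤ ‖x‖) ∧
      ∀ x, Tendsto (fun n => R n (gelfandOp j x)) atTop (𝓝 x) := by
  have hpos : ∀ n : ℕ, (0 : ℝ) < 1 / ((n : ℝ) + 1) := fun n => by positivity
  choose R hR hcomm using fun n => exists_resolvent_gelfandOp j (hpos n)
  -- With `y = Rₙ j* j x` one has `j* j (x - y) = εₙ y`, hence `⟪y, x - y⟫ ≥ 0`.
  have hcontr : ∀ n x, ‖R n (gelfandOp j x)‖ ≤ ‖x‖ := by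
    intro n x
    have h1 := hR n (gelfandOp j x)
    set y := R n (gelfandOp j x)
    have h2 : ⟪gelfandOp j (x - y), x - y⟫ = 1 / ((n : ℝ) + 1) * ⟪y, x - y⟫ := by
      rw [← real_inner_smul_left, map_sub, sub_eq_of_eq_add' h1.symm]
    rw [inner_gelfandOp_left, real_inner_self_eq_norm_sq] at h2
    have h3 : 0 ≤ ⟪y, x - y⟫ := by
      by_contra hneg
      nlinarith [hpos n, sq_nonneg ‖j (x - y)‖, mul_pos (hpos n) (neg_pos.2 (not_le.1 hneg))]
    rw [inner_sub_right, real_inner_self_eq_norm_sq] at h3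
    have h4 := real_inner_le_norm y x
    by_contra hlt
    nlinarith [norm_nonneg x, norm_nonneg y]
  refine ⟨R, hcomm, hcontr, fun x => ?_⟩
  rw [Metric.tendsto_atTop]
  intro δ hδ
  obtain ⟨z, hz⟩ := (denseRange_gelfandOp hj).exists_dist_lt x (show 0 < δ / 3 by linarith)
  obtain ⟨N, hN⟩ := exists_nat_gt (‖z‖ / (δ / 3))
  refine ⟨N, fun n hn => ?_⟩
  -- On the range of `j* j` the convergence is of order `εₙ`.
  set S : V →L[ℝ] V := (R n).comp (gelfandOp j)
  have h1 : ‖S (gelfandOp j z) - gelfandOp j z‖ ≤ 1 / ((n : ℝ) + 1) * ‖z‖ := by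
    have h2 : S (gelfandOp j z) - gelfandOp j z
        = -((1 / ((n : ℝ) + 1)) • R n (gelfandOp j z)) := by
      have h3 : S (gelfandOp j z) = gelfandOp j (R n (gelfandOp j z)) := hcomm n _
      rw [h3, eq_sub_of_add_eq (hR n (gelfandOp j z))]
      abel
    rw [h2, norm_neg, norm_smul, Real.norm_of_nonneg (hpos n).le]
    exact mul_le_mul_of_nonneg_left (hcontr n z) (hpos n).le
  have h2 : 1 / ((n : ℝ) + 1) * ‖z‖ < δ / 3 := by
    rw [div_lt_iff₀ (by linarith)] at hN
    have : (N : ℝ) ≤ n := by exact_mod_cast hn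
    rw [one_div, inv_mul_lt_iff₀ (by positivity)]
    nlinarith
  have h3 : ‖S (x - gelfandOp j z)‖ ≤ ‖x - gelfandOp j z‖ := hcontr n _
  have h4 : S x - x = S (x - gelfandOp j z) + (S (gelfandOp j z) - gelfandOp j z)
      + (gelfandOp j z - x) := by
    rw [map_sub]; abel
  rw [dist_eq_norm] at hz
  change dist (S x) x < δ
  rw [dist_eq_norm, h4]
  have h5 := norm_add₃_le (a := S (x - gelfandOp j z)) (b := S (gelfandOp j z) - gelfandOp j z)
    (c := gelfandOp j z - x)
  rw [norm_sub_rev (gelfandOp j z) x] at h5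
  linarith

end Resolvent

end

/-! ### The energy identity for regularized curves -/

noncomputable section

section Trace

variable {V H : Type*} [NormedAddCommGroup V] [InnerProductSpace ℝ V] [CompleteSpace V]
  [NormedAddCommGroup H] [InnerProductSpace ℝ H] [CompleteSpace H]

theorem intervalIntegrable_of_integrable_timeMeasure {E : Type*} [NormedAddCommGroup E] {T : ℝ}
    (hT : 0 ≤ T) {f : ℝ → E} (hf : Integrable f (timeMeasure T)) :
    IntervalIntegrable f volume 0 T := by
  rw [intervalIntegrable_iff_integrableOn_Ioc_of_le hT, integrableOn_Ioc_iff_integrableOn_Ioo]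
  exact hf

theorem intervalIntegral_eq_integral_timeMeasure {E : Type*} [NormedAddCommGroup E]
    [NormedSpace ℝ E] {T : ℝ} (hT : 0 ≤ T) (f : ℝ → E) :
    ∫ t in (0 : ℝ)..T, f t = ∫ t, f t ∂(timeMeasure T) := by
  rw [intervalIntegral.integral_of_le hT, integral_Ioc_eq_integral_Ioo]

/-- If `F` is the weak derivative of `w` in the Gelfand triple, then `j* j w` is a primitive
of `F`. -/
theorem exists_gelfandOp_ae_eq_primitive {j : V →L[ℝ] H} {T : ℝ} (hT : 0 < T) {w F : ℝ → V}
    (hw : Integrable w (timeMeasure T)) (hF : Integrable F (timeMeasure T))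
    (h : ∀ φ : ℝ → ℝ, ContDiff ℝ ∞ φ → HasCompactSupport φ → tsupport φ ⊆ Ioo 0 T → ∀ v : V,
      ∫ t, deriv φ t * ⟪j (w t), j v⟫ ∂(timeMeasure T)
        = -∫ t, φ t * ⟪F t, v⟫ ∂(timeMeasure T)) :
    ∃ z₀ : V, ∀ᵐ t ∂(timeMeasure T), gelfandOp j (w t) = z₀ + ∫ τ in (0 : ℝ)..t, F τ := by
  have hFi := intervalIntegrable_of_integrable_timeMeasure hT.le hF
  have hcont : ContinuousOn (fun t => ∫ τ in (0 : ℝ)..t, F τ) (Icc 0 T) := by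
    have := intervalIntegral.continuousOn_primitive_interval (a := 0) (b := T)
      (f := F) (μ := volume) (by
        rw [uIcc_of_le hT.le]
        exact (intervalIntegrable_iff_integrableOn_Icc_of_le hT.le).1 hFi)
    rwa [uIcc_of_le hT.le] at this
  have hPI : Integrable (fun t => ∫ τ in (0 : ℝ)..t, F τ) (timeMeasure T) :=
    (hcont.integrableOn_compact isCompact_Icc).mono_set Ioo_subset_Icc_self
  have hKI : Integrable (fun t => gelfandOp j (w t)) (timeMeasure T) :=
    (gelfandOp j).integrable_comp hw
  have hweak : ∀ φ : ℝ → ℝ, ContDiff ℝ ∞ φ → HasCompactSupport φ → tsupport φ ⊆ Ioo 0 T →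
      ∫ t in Ioo 0 T, deriv φ t • (gelfandOp j (w t) - ∫ τ in (0 : ℝ)..t, F τ) = 0 := by
    intro φ hφ hφc hφt
    have hdc : Continuous (deriv φ) := hφ.continuous_deriv (by simp)
    obtain ⟨M, hM⟩ := hφc.deriv.exists_bound_of_continuous hdc
    have hb : ∀ {g : ℝ → V}, Integrable g (timeMeasure T) →
        Integrable (fun t => deriv φ t • g t) (timeMeasure T) := fun hg =>
      hg.bdd_smul M hdc.aestronglyMeasurable (Eventually.of_forall hM)
    have h0 : ∀ t, t ∉ Ioo 0 T → φ t = 0 := fun t ht =>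
      image_eq_zero_of_notMem_tsupport fun h => ht (hφt h)
    refine ext_inner_left ℝ fun v => ?_
    have hsub : Integrable (fun t => gelfandOp j (w t) - ∫ τ in (0 : ℝ)..t, F τ) (timeMeasure T) :=
      hKI.sub hPI
    rw [← integral_inner (hb hsub), inner_zero_right]
    have hFv : Integrable (fun t => ⟪F t, v⟫) (timeMeasure T) := hF.inner_const v
    have h2 := integral_deriv_mul_primitive
      (intervalIntegrable_of_integrable_timeMeasure hT.le hFv) hφ (h0 0 (by simp)) (h0 T (by simp))
    rw [intervalIntegral_eq_integral_timeMeasure hT.le,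
      intervalIntegral_eq_integral_timeMeasure hT.le, ← h φ hφ hφc hφt v] at h2
    have h3 : ∀ᵐ t ∂(timeMeasure T), ∫ τ in (0 : ℝ)..t, ⟪F τ, v⟫
        = ⟪v, ∫ τ in (0 : ℝ)..t, F τ⟫ := by
      rw [ae_restrict_iff' measurableSet_Ioo]
      refine Eventually.of_forall fun t ht => ?_
      have hi : IntervalIntegrable F volume 0 t := hFi.mono_set (by
        rw [uIcc_of_le hT.le, uIcc_of_le ht.1.le]; exact Icc_subset_Icc_right ht.2.le)
      have := (innerSL ℝ v).intervalIntegral_comp_comm hi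
      simp only [innerSL_apply_apply] at this
      rw [← this]
      simp only [real_inner_comm]
    have h4 : ∫ t, ⟪v, deriv φ t • (gelfandOp j (w t) - ∫ τ in (0 : ℝ)..t, F τ)⟫ ∂(timeMeasure T)
        = ∫ t, (deriv φ t * ⟪j (w t), j v⟫ - deriv φ t * ∫ τ in (0 : ℝ)..t, ⟪F τ, v⟫)
          ∂(timeMeasure T) := by
      refine integral_congr_ae ?_
      filter_upwards [h3] with t ht
      rw [ht, real_inner_smul_right, inner_sub_right, inner_gelfandOp_right, real_inner_comm]
      ring
    rw [h4, integral_sub, h2, sub_self]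
    · refine (((hb hKI).inner_const v)).congr (Eventually.of_forall fun t => ?_)
      simp only [real_inner_smul_left, inner_gelfandOp_left]
    · refine (((hb hPI).inner_const v)).congr ?_
      filter_upwards [h3] with t ht
      rw [ht, real_inner_smul_left, real_inner_comm]
  obtain ⟨c, hc⟩ := exists_ae_eq_const_of_integral_deriv_smul_eq_zero hT (hKI.sub hPI) hweak
  exact ⟨c, hc.mono fun t ht => by rw [← ht]; simp⟩

/-- The energy estimate and the energy identity for the smoothed curve `j R (j* j w)`, where `R`
commutes with `j* j`. Both are expressed by `R j* j w` and `R j* j F` only, which makes them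
uniform along an approximate inverse `R` of `j* j`. -/
theorem energy_of_commute {j : V →L[ℝ] H} {T : ℝ} (hT : 0 < T) {w F : ℝ → V}
    (hw : MemLp w 2 (timeMeasure T)) (hF : MemLp F 2 (timeMeasure T)) {z₀ : V}
    (hz : ∀ᵐ t ∂(timeMeasure T), gelfandOp j (w t) = z₀ + ∫ τ in (0 : ℝ)..t, F τ)
    (R : V →L[ℝ] V) (hR : ∀ x, R (gelfandOp j x) = gelfandOp j (R x))
    {y : ℝ → H} (hy : y = fun t => j (R (z₀ + ∫ τ in (0 : ℝ)..t, F τ))) :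
    ContinuousOn y (Icc 0 T) ∧
    (∀ t ∈ Icc 0 T, ‖y t‖ ^ 2 ≤ (‖j‖ ^ 2 / T + 1) *
      (∫ t, ‖R (gelfandOp j (w t))‖ ^ 2 ∂(timeMeasure T)
        + ∫ t, ‖R (gelfandOp j (F t))‖ ^ 2 ∂(timeMeasure T))) ∧
    ‖y T‖ ^ 2 - ‖y 0‖ ^ 2
      = 2 * ∫ t, ⟪R (gelfandOp j (F t)), R (gelfandOp j (w t))⟫ ∂(timeMeasure T) := by
  have h2 : (1 : ENNReal) ≤ 2 := by norm_num
  have hFi := intervalIntegrable_of_integrable_timeMeasure hT.le (hF.integrable h2)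
  set Q : V →L[ℝ] H := j.comp R
  set S : V →L[ℝ] V := R.comp (gelfandOp j)
  have hSw : MemLp (fun t => S (w t)) 2 (timeMeasure T) := hw.continuousLinearMap_comp S
  have hSF : MemLp (fun t => S (F t)) 2 (timeMeasure T) := hF.continuousLinearMap_comp S
  have hQi : IntervalIntegrable (fun t => Q (F t)) volume 0 T :=
    intervalIntegrable_of_integrable_timeMeasure hT.le (Q.integrable_comp (hF.integrable h2))
  have hmem : ∀ {t}, t ∈ Icc 0 T → uIcc 0 t ⊆ uIcc 0 T := fun {t} ht => by
    rw [uIcc_of_le hT.le, uIcc_of_le ht.1]; exact Icc_subset_Icc_right ht.2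
  have hyQ : ∀ t ∈ Icc 0 T, y t = Q z₀ + ∫ τ in (0 : ℝ)..t, Q (F τ) := by
    intro t ht
    rw [Q.intervalIntegral_comp_comm (hFi.mono_set (hmem ht)), ← map_add, hy]
    rfl
  have hyw : ∀ᵐ t ∂(timeMeasure T), y t = j (S (w t)) := by
    filter_upwards [hz] with t ht
    simp only [hy, ← ht]
    rfl
  have hcont : ContinuousOn y (Icc 0 T) := by
    refine ContinuousOn.congr (f := fun t => Q z₀ + ∫ τ in (0 : ℝ)..t, Q (F τ)) ?_ hyQ
    refine continuousOn_const.add ?_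
    have := intervalIntegral.continuousOn_primitive_interval (a := 0) (b := T)
      (f := fun τ => Q (F τ)) (μ := volume) (by
        rw [uIcc_of_le hT.le]
        exact (intervalIntegrable_iff_integrableOn_Icc_of_le hT.le).1 hQi)
    rwa [uIcc_of_le hT.le] at this
  have hinner : ∀ᵐ t ∂(timeMeasure T),
      2 * ⟪Q z₀ + ∫ τ in (0 : ℝ)..t, Q (F τ), Q (F t)⟫ = 2 * ⟪S (F t), S (w t)⟫ := by
    have hI : ∀ᵐ t ∂(timeMeasure T), t ∈ Ioo 0 T := ae_restrict_mem measurableSet_Ioo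
    filter_upwards [hyw, hI] with t ht htI
    rw [← hyQ t (Ioo_subset_Icc_self htI), ht]
    change 2 * ⟪j (S (w t)), j (R (F t))⟫ = 2 * ⟪R (gelfandOp j (F t)), S (w t)⟫
    rw [hR, inner_gelfandOp_left, real_inner_comm]
  have hdom : Integrable (fun t => ‖S (w t)‖ ^ 2 + ‖S (F t)‖ ^ 2) (timeMeasure T) :=
    (hSw.integrable_norm_pow (by norm_num)).add (hSF.integrable_norm_pow (by norm_num))
  have hSI : Integrable (fun t => ‖S (w t)‖ ^ 2) (timeMeasure T) :=
    hSw.integrable_norm_pow (by norm_num)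
  have hFI : Integrable (fun t => ‖S (F t)‖ ^ 2) (timeMeasure T) :=
    hSF.integrable_norm_pow (by norm_num)
  set D := ∫ t, ‖S (w t)‖ ^ 2 ∂(timeMeasure T) + ∫ t, ‖S (F t)‖ ^ 2 ∂(timeMeasure T) with hD
  have hstep : ∀ t ∈ Icc 0 T, ∀ s ∈ Icc 0 T, ‖y t‖ ^ 2 ≤ ‖y s‖ ^ 2 + D := by
    intro t ht s hs
    have h3 := norm_sq_sub_norm_sq_eq_integral hT.le hQi (Q z₀) hs ht
    rw [← hyQ t ht, ← hyQ s hs] at h3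
    have hsub : uIoc s t ⊆ Ioc 0 T := by
      rw [← uIoc_of_le hT.le]
      exact uIoc_subset_uIoc_of_uIcc_subset_uIcc (by
        rw [uIcc_of_le hT.le]; exact uIcc_subset_Icc hs ht)
    have h4 : |∫ σ in s..t, 2 * ⟪Q z₀ + ∫ τ in (0 : ℝ)..σ, Q (F τ), Q (F σ)⟫| ≤ D := by
      have hdI : IntegrableOn (fun t => ‖S (w t)‖ ^ 2 + ‖S (F t)‖ ^ 2) (Ioc 0 T) := by
        rw [integrableOn_Ioc_iff_integrableOn_Ioo]; exact hdom
      rw [hD, ← integral_add hSI hFI, ← integral_Ioc_eq_integral_Ioo, ← Real.norm_eq_abs,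
        intervalIntegral.norm_integral_eq_norm_integral_uIoc]
      refine (norm_integral_le_of_norm_le (hdI.mono_set hsub) ?_).trans
        (setIntegral_mono_set hdI (Eventually.of_forall fun t => by positivity)
          hsub.eventuallyLE)
      refine ae_mono (Measure.restrict_mono hsub le_rfl) ?_
      rw [← restrict_Ioo_eq_restrict_Ioc]
      filter_upwards [hinner] with σ hσ
      rw [hσ, Real.norm_eq_abs, abs_mul, abs_two]
      have := abs_real_inner_le_norm (S (F σ)) (S (w σ))
      nlinarith [sq_nonneg (‖S (F σ)‖ - ‖S (w σ)‖)]
    linarith [le_abs_self (∫ σ in s..t, 2 * ⟪Q z₀ + ∫ τ in (0 : ℝ)..σ, Q (F τ), Q (F σ)⟫)]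
  refine ⟨hcont, fun t ht => ?_, ?_⟩
  · -- Average the bound by the value at `s` over all `s ∈ (0, T)`.
    have h5 : ∫ _, ‖y t‖ ^ 2 ∂(timeMeasure T)
        ≤ ∫ s, (‖j‖ ^ 2 * ‖S (w s)‖ ^ 2 + D) ∂(timeMeasure T) := by
      refine integral_mono_ae (integrable_const _)
        ((hSI.const_mul _).add (integrable_const _)) ?_
      have hI : ∀ᵐ t ∂(timeMeasure T), t ∈ Ioo 0 T := ae_restrict_mem measurableSet_Ioo
      filter_upwards [hyw, hI] with s hs hsI
      refine (hstep t ht s (Ioo_subset_Icc_self hsI)).trans ?_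
      rw [hs, ← mul_pow]
      gcongr
      exact j.le_opNorm _
    rw [integral_add (hSI.const_mul _) (integrable_const _), integral_const_mul] at h5
    simp only [integral_const, measureReal_restrict_apply_univ, Real.volume_real_Ioo_of_le hT.le,
      sub_zero, smul_eq_mul] at h5
    have h6 : ∫ t, ‖S (w t)‖ ^ 2 ∂(timeMeasure T) ≤ D :=
      le_add_of_nonneg_right (integral_nonneg fun t => by positivity)
    have h7 : T * ‖y t‖ ^ 2 ≤ T * ((‖j‖ ^ 2 / T + 1) * D) := by
      have : T * ((‖j‖ ^ 2 / T + 1) * D) = ‖j‖ ^ 2 * D + T * D := by field_simp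
      nlinarith [mul_le_mul_of_nonneg_left h6 (sq_nonneg ‖j‖)]
    exact le_of_mul_le_mul_left h7 hT
  · have h3 := norm_sq_sub_norm_sq_eq_integral hT.le hQi (Q z₀) (s := 0) (t := T)
      ⟨le_rfl, hT.le⟩ ⟨hT.le, le_rfl⟩
    rw [← hyQ T ⟨hT.le, le_rfl⟩, ← hyQ 0 ⟨le_rfl, hT.le⟩,
      intervalIntegral_eq_integral_timeMeasure hT.le, integral_congr_ae hinner,
      integral_const_mul] at h3
    exact h3

end Trace

end

/-! ### The continuous representative -/

noncomputable section

theorem tendsto_integral_norm_sub_sq {E : Type*} [NormedAddCommGroup E] [NormedSpace ℝ E]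
    {μ : Measure ℝ} {f : ℝ → E} (hf : MemLp f 2 μ)
    {S : ℕ → E →L[ℝ] E} (hS : ∀ n x, ‖S n x‖ ≤ ‖x‖)
    (hlim : ∀ x, Tendsto (fun n => S n x) atTop (𝓝 x)) :
    Tendsto (fun n => ∫ t, ‖S n (f t) - f t‖ ^ 2 ∂μ) atTop (𝓝 0) := by
  have hb : Integrable (fun t => 4 * ‖f t‖ ^ 2) μ :=
    (hf.integrable_norm_pow (p := 2) (by norm_num)).const_mul 4
  have := tendsto_integral_of_dominated_convergence (μ := μ)
    (F := fun n t => ‖S n (f t) - f t‖ ^ 2) (f := fun _ => (0 : ℝ)) _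
    (fun n => ?_) hb (fun n => Eventually.of_forall fun t => ?_)
    (Eventually.of_forall fun t => ?_)
  · simpa using this
  · exact (((hf.continuousLinearMap_comp (S n)).aestronglyMeasurable.sub
      hf.aestronglyMeasurable).norm.pow 2)
  · rw [Real.norm_of_nonneg (by positivity)]
    have h1 := norm_sub_le (S n (f t)) (f t)
    have h2 := hS n (f t)
    calc ‖S n (f t) - f t‖ ^ 2 ≤ (2 * ‖f t‖) ^ 2 := by gcongr; linarith
      _ = 4 * ‖f t‖ ^ 2 := by ring
  · have h := ((hlim (f t)).sub_const (f t)).norm.pow 2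
    simpa using h

section Trace

variable {V H : Type*} [NormedAddCommGroup V] [InnerProductSpace ℝ V] [CompleteSpace V]
  [NormedAddCommGroup H] [InnerProductSpace ℝ H] [CompleteSpace H]

/-- An element of `L₂(I; V) ∩ H¹(I; V')` has a representative in `C([0, T]; H)`, which is bounded by
its norm and satisfies the energy identity. Here the weak derivative in `V'` is represented by the
`V`-valued function `F`. -/
theorem exists_continuousOn_representative {j : V →L[ℝ] H} (hj : Function.Injective j) {T : ℝ}
    (hT : 0 < T) {w F : ℝ → V}
    (hw : MemLp w 2 (timeMeasure T)) (hF : MemLp F 2 (timeMeasure T))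
    (h : ∀ φ : ℝ → ℝ, ContDiff ℝ ∞ φ → HasCompactSupport φ → tsupport φ ⊆ Ioo 0 T → ∀ v : V,
      ∫ t, deriv φ t * ⟪j (w t), j v⟫ ∂(timeMeasure T)
        = -∫ t, φ t * ⟪F t, v⟫ ∂(timeMeasure T)) :
    ∃ W : ℝ → H, ContinuousOn W (Icc 0 T) ∧ (fun t => j (w t)) =ᵐ[timeMeasure T] W ∧
      (∀ t ∈ Icc 0 T, ‖W t‖ ^ 2 ≤ (‖j‖ ^ 2 / T + 1) *
        (∫ t, ‖w t‖ ^ 2 ∂(timeMeasure T) + ∫ t, ‖F t‖ ^ 2 ∂(timeMeasure T))) ∧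
      ‖W T‖ ^ 2 - ‖W 0‖ ^ 2 = 2 * ∫ t, ⟪F t, w t⟫ ∂(timeMeasure T) := by
  have h2 : (1 : ENNReal) ≤ 2 := by norm_num
  obtain ⟨z₀, hz⟩ := exists_gelfandOp_ae_eq_primitive hT (hw.integrable h2) (hF.integrable h2) h
  obtain ⟨R, hcomm, hcontr, hlim⟩ := exists_approximate_inverse_gelfandOp hj
  set C : ℝ := ‖j‖ ^ 2 / T + 1
  have hC : 0 < C := by positivity
  set S : ℕ → V →L[ℝ] V := fun n => (R n).comp (gelfandOp j)
  set Z : ℝ → V := fun t => z₀ + ∫ τ in (0 : ℝ)..t, F τ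
  set y : ℕ → ℝ → H := fun n t => j (R n (Z t)) with hy
  set e : ℕ → ℝ := fun n => ∫ t, ‖S n (w t) - w t‖ ^ 2 ∂(timeMeasure T)
    + ∫ t, ‖S n (F t) - F t‖ ^ 2 ∂(timeMeasure T) with he
  have he0 : Tendsto e atTop (𝓝 0) := by
    simpa using (tendsto_integral_norm_sub_sq hw (S := S) hcontr hlim).add
      (tendsto_integral_norm_sub_sq hF (S := S) hcontr hlim)
  have hsq : ∀ {f : ℝ → V}, MemLp f 2 (timeMeasure T) →
      Integrable (fun t => ‖f t‖ ^ 2) (timeMeasure T) := fun hf =>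
    hf.integrable_norm_pow (p := 2) (by norm_num)
  have hSm : ∀ (n) {f : ℝ → V}, MemLp f 2 (timeMeasure T) →
      MemLp (fun t => S n (f t)) 2 (timeMeasure T) := fun n f hf =>
    hf.continuousLinearMap_comp (S n)
  -- The curves `y n - y m` obey the energy estimate with `R n - R m`, which also commutes with
  -- `j* j`; hence they converge uniformly in `H`.
  have hdiff : ∀ n m {f : ℝ → V}, MemLp f 2 (timeMeasure T) →
      ∫ t, ‖(R n - R m) (gelfandOp j (f t))‖ ^ 2 ∂(timeMeasure T) ≤
        2 * ∫ t, ‖S n (f t) - f t‖ ^ 2 ∂(timeMeasure T)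
          + 2 * ∫ t, ‖S m (f t) - f t‖ ^ 2 ∂(timeMeasure T) := by
    intro n m f hf
    have hn := (hsq ((hSm n hf).sub hf)).const_mul 2
    have hm := (hsq ((hSm m hf).sub hf)).const_mul 2
    simp only [Pi.sub_apply] at hn hm
    rw [← integral_const_mul, ← integral_const_mul, ← integral_add hn hm]
    refine integral_mono_of_nonneg (Eventually.of_forall fun t => by positivity) (hn.add hm)
      (Eventually.of_forall fun t => ?_)
    have h3 : (R n - R m) (gelfandOp j (f t)) = (S n (f t) - f t) - (S m (f t) - f t) := by
      simp [S]
    have h4 := norm_sub_le (S n (f t) - f t) (S m (f t) - f t)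
    simp only [h3]
    nlinarith [norm_nonneg ((S n (f t) - f t) - (S m (f t) - f t)),
      sq_nonneg (‖S n (f t) - f t‖ - ‖S m (f t) - f t‖)]
  have hcau : ∀ n m, ∀ t ∈ Icc 0 T, ‖y n t - y m t‖ ^ 2 ≤ C * (2 * e n + 2 * e m) := by
    intro n m t ht
    have h3 := (energy_of_commute hT hw hF hz (R n - R m)
      (fun x => by simp [hcomm]) rfl).2.1 t ht
    have h4 : j ((R n - R m) (z₀ + ∫ τ in (0 : ℝ)..t, F τ)) = y n t - y m t := by
      simp [hy, Z]
    rw [h4] at h3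
    refine h3.trans (mul_le_mul_of_nonneg_left ?_ hC.le)
    have := hdiff n m hw
    have := hdiff n m hF
    simp only [he]
    linarith
  have hunif : UniformCauchySeqOn y atTop (Icc 0 T) := by
    rw [Metric.uniformCauchySeqOn_iff]
    intro ε hε
    have hδ : 0 < ε ^ 2 / (4 * C) := by positivity
    obtain ⟨N, hN⟩ := eventually_atTop.1 (he0.eventually_lt_const hδ)
    refine ⟨N, fun m hm n hn t ht => ?_⟩
    rw [dist_eq_norm]
    refine lt_of_pow_lt_pow_left₀ 2 hε.le ((hcau m n t ht).trans_lt ?_)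
    have h3 := hN m hm
    have h4 := hN n hn
    rw [lt_div_iff₀ (by positivity)] at h3 h4
    linarith
  have hex : ∀ t, ∃ x, t ∈ Icc 0 T → Tendsto (fun n => y n t) atTop (𝓝 x) := by
    intro t
    by_cases ht : t ∈ Icc 0 T
    · obtain ⟨x, hx⟩ := cauchySeq_tendsto_of_complete (hunif.cauchySeq ht)
      exact ⟨x, fun _ => hx⟩
    · exact ⟨0, fun h => absurd h ht⟩
  choose W hW using hex
  have hTU : TendstoUniformlyOn y W atTop (Icc 0 T) := hunif.tendstoUniformlyOn_of_tendsto hW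
  have hen := fun n => energy_of_commute hT hw hF hz (R n) (hcomm n) (y := y n) rfl
  have hle : ∀ (n) {f : ℝ → V}, MemLp f 2 (timeMeasure T) →
      ∫ t, ‖R n (gelfandOp j (f t))‖ ^ 2 ∂(timeMeasure T) ≤ ∫ t, ‖f t‖ ^ 2 ∂(timeMeasure T) :=
    fun n f hf => integral_mono_of_nonneg (Eventually.of_forall fun t => by positivity) (hsq hf)
      (Eventually.of_forall fun t => pow_le_pow_left₀ (norm_nonneg _) (hcontr n (f t)) 2)
  refine ⟨W, hTU.continuousOn (Frequently.of_forall fun n => (hen n).1), ?_, fun t ht => ?_, ?_⟩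
  · have hI : ∀ᵐ t ∂(timeMeasure T), t ∈ Ioo 0 T := ae_restrict_mem measurableSet_Ioo
    filter_upwards [hz, hI] with t ht htI
    refine tendsto_nhds_unique ?_ (hW t (Ioo_subset_Icc_self htI))
    have : ∀ n, y n t = j (S n (w t)) := fun n => by
      simp only [hy, Z, ← ht]
      rfl
    simp only [this]
    exact (j.continuous.tendsto _).comp (hlim (w t))
  · refine le_of_tendsto ((hW t ht).norm.pow 2) (Eventually.of_forall fun n => ?_)
    exact ((hen n).2.1 t ht).trans
      (mul_le_mul_of_nonneg_left (add_le_add (hle n hw) (hle n hF)) hC.le)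
  · have hT0 := (hW T ⟨hT.le, le_rfl⟩).norm.pow 2
    have h00 := (hW 0 ⟨le_rfl, hT.le⟩).norm.pow 2
    refine tendsto_nhds_unique (hT0.sub h00) ?_
    simp only [fun n => (hen n).2.2]
    refine Tendsto.const_mul 2 (tendsto_integral_of_dominated_convergence
      (fun t => ‖F t‖ * ‖w t‖) (fun n => ?_) (hF.norm.integrable_mul hw.norm)
      (fun n => Eventually.of_forall fun t => ?_) (Eventually.of_forall fun t => ?_))
    · exact (hSm n hF).aestronglyMeasurable.inner (hSm n hw).aestronglyMeasurable
    · exact (abs_real_inner_le_norm _ _).trans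
        (mul_le_mul (hcontr n _) (hcontr n _) (norm_nonneg _) (norm_nonneg _))
    · exact (hlim (F t)).inner (hlim (w t))

end Trace

end

/-! ### The trace operators and integration by parts in time -/

noncomputable section

section TraceOperator

theorem integral_norm_sq_le {E : Type*} [NormedAddCommGroup E] {T : ℝ}
    (f : Lp E 2 (timeMeasure T)) : ∫ t, ‖f t‖ ^ 2 ∂(timeMeasure T) ≤ ‖f‖ ^ 2 := by
  simpa only [sq] using integral_norm_mul_le f f

/-- The Riesz isomorphism `V' → V` of a real Hilbert space as a linear map. -/
theorem exists_riesz_clm (V : Type*) [NormedAddCommGroup V] [InnerProductSpace ℝ V]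
    [CompleteSpace V] : ∃ ι : StrongDual ℝ V →L[ℝ] V, (∀ f v, ⟪ι f, v⟫ = f v) ∧
      ∀ f, ‖ι f‖ = ‖f‖ := by
  let ι : StrongDual ℝ V →ₗᵢ[ℝ] V :=
    { toFun := (InnerProductSpace.toDual ℝ V).symm
      map_add' := map_add _
      map_smul' := fun c f => by simp
      norm_map' := (InnerProductSpace.toDual ℝ V).symm.norm_map }
  exact ⟨ι.toContinuousLinearMap, fun f v => InnerProductSpace.toDual_symm_apply,
    ι.norm_map⟩

variable {V H : Type*} [NormedAddCommGroup V] [InnerProductSpace ℝ V] [CompleteSpace V]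
  [NormedAddCommGroup H] [InnerProductSpace ℝ H] [CompleteSpace H] {j : V →L[ℝ] H} {T : ℝ}

theorem exists_trace_representative (hj : Function.Injective j) (hT : 0 < T) (w : SpaceX j T) :
    ∃ W : ℝ → H, ContinuousOn W (Icc 0 T) ∧ (fun t => j (embY w t)) =ᵐ[timeMeasure T] W ∧
      (∀ t ∈ Icc 0 T, ‖W t‖ ^ 2 ≤ (‖j‖ ^ 2 / T + 1) * (‖embY w‖ ^ 2 + ‖weakDt w‖ ^ 2)) ∧
      ‖W T‖ ^ 2 - ‖W 0‖ ^ 2 = 2 * opDt w (embY w) := by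
  obtain ⟨ι, hι, hιn⟩ := exists_riesz_clm V
  have hF : MemLp (fun t => ι (weakDt w t)) 2 (timeMeasure T) :=
    (Lp.memLp (weakDt w)).continuousLinearMap_comp ι
  obtain ⟨W, hW, hae, hb, hid⟩ := exists_continuousOn_representative hj hT
    (Lp.memLp (embY w)) hF (fun φ hφ hs ht v => by
      simp only [hι]
      exact w.2 φ hφ hs ht v)
  refine ⟨W, hW, hae, fun t ht => (hb t ht).trans ?_, ?_⟩
  · simp only [hιn]
    exact mul_le_mul_of_nonneg_left
      (add_le_add (integral_norm_sq_le _) (integral_norm_sq_le _)) (by positivity)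
  · rw [hid, opDt_apply]
    simp only [hι]

omit [CompleteSpace V] [CompleteSpace H] in
/-- The trace does not depend on the continuous representative chosen in its definition. -/
theorem trace_eq (hT : 0 < T) {w : SpaceX j T} {W : ℝ → H} (hW : ContinuousOn W (Icc 0 T))
    (hae : (fun t => j (embY w t)) =ᵐ[timeMeasure T] W) {t : ℝ} (ht : t ∈ Icc 0 T) :
    trace t w = W t := by
  have h : ∃ W : ℝ → H, ContinuousOn W (Icc 0 T) ∧
      (fun s => j (embY w s)) =ᵐ[timeMeasure T] W := ⟨W, hW, hae⟩
  rw [trace, dif_pos h]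
  have hc := h.choose_spec
  have h1 : EqOn h.choose W (Ioo 0 T) :=
    Measure.eqOn_open_of_ae_eq (hc.2.symm.trans hae) isOpen_Ioo
      (hc.1.mono Ioo_subset_Icc_self) (hW.mono Ioo_subset_Icc_self)
  exact h1.of_subset_closure hc.1 hW Ioo_subset_Icc_self (by rw [closure_Ioo hT.ne]) ht

/-- The trace `γ_t : X → H` as a bounded operator. -/
theorem exists_trace_clm (hj : Function.Injective j) (hT : 0 < T) {t : ℝ} (ht : t ∈ Icc 0 T) :
    ∃ γ : SpaceX j T →L[ℝ] H, ∀ w, γ w = trace t w := by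
  choose W hW hae hb hid using fun w : SpaceX j T => exists_trace_representative hj hT w
  have heq : ∀ w, trace t w = W w t := fun w => trace_eq hT (hW w) (hae w) ht
  let γ : SpaceX j T →ₗ[ℝ] H :=
    { toFun := fun w => trace t w
      map_add' := fun w z => by
        rw [heq w, heq z]
        refine trace_eq (W := fun t => W w t + W z t) hT ((hW w).add (hW z)) ?_ ht
        filter_upwards [hae w, hae z, Lp.coeFn_add (embY w) (embY z)] with s h1 h2 h3
        rw [← h1, ← h2, map_add, h3, Pi.add_apply, map_add]
      map_smul' := fun c w => by
        rw [heq w]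
        refine trace_eq (W := fun t => c • W w t) hT ((hW w).const_smul c) ?_ ht
        filter_upwards [hae w, Lp.coeFn_smul c (embY w)] with s h1 h2
        rw [← h1, map_smul, h2, Pi.smul_apply, map_smul] }
  refine ⟨γ.mkContinuous √((‖j‖ ^ 2 / T + 1) * 2) fun w => ?_, fun w => rfl⟩
  have h1 : ‖embY w‖ ≤ ‖w‖ := norm_fst_le (w : SpaceY V T × SpaceDualValued V T)
  have h2 : ‖weakDt w‖ ≤ ‖w‖ := norm_snd_le (w : SpaceY V T × SpaceDualValued V T)
  refine le_of_sq_le_sq ?_ (by positivity)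
  rw [mul_pow, Real.sq_sqrt (by positivity), mul_assoc]
  change ‖trace t w‖ ^ 2 ≤ _
  rw [heq]
  refine (hb w t ht).trans (mul_le_mul_of_nonneg_left ?_ (by positivity))
  nlinarith [norm_nonneg (embY w), norm_nonneg (weakDt w)]

/-- Integration by parts in time. -/
theorem opDt_add_opDt (hj : Function.Injective j) (hT : 0 < T) (w z : SpaceX j T) :
    opDt w (embY z) + opDt z (embY w)
      = ⟪trace T w, trace T z⟫ - ⟪trace 0 w, trace 0 z⟫ := by
  have hT0 : (0 : ℝ) ∈ Icc 0 T := ⟨le_rfl, hT.le⟩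
  have hTT : T ∈ Icc 0 T := ⟨hT.le, le_rfl⟩
  obtain ⟨γ₀, h0⟩ := exists_trace_clm hj hT hT0
  obtain ⟨γT, h1⟩ := exists_trace_clm hj hT hTT
  have key : ∀ w : SpaceX j T, ‖γT w‖ ^ 2 - ‖γ₀ w‖ ^ 2 = 2 * opDt w (embY w) := fun w => by
    obtain ⟨W, hW, hae, -, hid⟩ := exists_trace_representative hj hT w
    rw [h0, h1, trace_eq hT hW hae hT0, trace_eq hT hW hae hTT, hid]
  have h2 := key (w + z)
  have h3 := key w
  have h4 := key z
  simp only [map_add, norm_add_sq_real, add_apply] at h2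
  rw [← h0, ← h0, ← h1, ← h1]
  linarith

omit [CompleteSpace H] in
/-- The norm of `L₂(I; V')` is dominated by that of `Y'`: test with the Riesz representative. -/
theorem norm_weakDt_le (w : SpaceX j T) : ‖weakDt w‖ ≤ ‖opDt w‖ := by
  obtain ⟨ι, hιi, hιn⟩ := exists_riesz_clm V
  have hι : ∀ f : StrongDual ℝ V, f (ι f) = ‖f‖ ^ 2 := fun f => by
    rw [← hιi f (ι f), real_inner_self_eq_norm_sq, hιn]
  set v : SpaceY V T := ι.compLp (weakDt w)
  have hv : ∀ᵐ t ∂(timeMeasure T), v t = ι (weakDt w t) := ι.coeFn_compLp _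
  have hn : ‖v‖ = ‖weakDt w‖ := by
    refine le_antisymm (Lp.norm_le_norm_of_ae_le ?_) (Lp.norm_le_norm_of_ae_le ?_) <;>
    · filter_upwards [hv] with t ht
      rw [ht, hιn]
  have h1 : opDt w v = ‖v‖ ^ 2 := by
    rw [opDt_apply, ← real_inner_self_eq_norm_sq, L2.inner_def]
    refine integral_congr_ae ?_
    filter_upwards [hv] with t ht
    rw [ht, hι, real_inner_self_eq_norm_sq, hιn]
  have h2 := (opDt w).le_opNorm v
  rw [h1, Real.norm_of_nonneg (by positivity), hn, sq] at h2
  rcases (norm_nonneg (weakDt w)).eq_or_lt with h | h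
  · rw [← h]; positivity
  · exact le_of_mul_le_mul_right h2 h

/-- The weak derivative is a closed operator. -/
theorem isClosed_spaceX (j : V →L[ℝ] H) (T : ℝ) :
    IsClosed (SpaceX j T : Set (SpaceY V T × SpaceDualValued V T)) := by
  have hmem : ∀ {φ : ℝ → ℝ}, Continuous φ → HasCompactSupport φ → ∀ v : V,
      MemLp (fun t => φ t • v) 2 (timeMeasure T) := fun hφ hs v => by
    obtain ⟨M, hM⟩ := hs.exists_bound_of_continuous hφ
    refine MemLp.of_bound (hφ.aestronglyMeasurable.smul_const v) (M * ‖v‖)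
      (Eventually.of_forall fun t => ?_)
    rw [norm_smul]
    exact mul_le_mul_of_nonneg_right (hM t) (norm_nonneg v)
  have : (SpaceX j T : Set (SpaceY V T × SpaceDualValued V T)) =
      {p | ∀ φ : ℝ → ℝ, ContDiff ℝ ∞ φ → HasCompactSupport φ → tsupport φ ⊆ Ioo 0 T → ∀ v : V,
        ∫ t, deriv φ t * ⟪j (p.1 t), j v⟫ ∂(timeMeasure T)
          = -∫ t, φ t * p.2 t v ∂(timeMeasure T)} := rfl
  rw [this]
  simp only [ofPred_forall]
  refine isClosed_iInter fun φ => isClosed_iInter fun hφ => isClosed_iInter fun hs =>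
    isClosed_iInter fun _ => isClosed_iInter fun v => isClosed_eq ?_ (Continuous.neg ?_)
  · have hm := hmem (hφ.continuous_deriv (by simp)) hs.deriv
      (ContinuousLinearMap.adjoint j (j v))
    have : ∀ p : SpaceY V T × SpaceDualValued V T,
        ∫ t, deriv φ t * ⟪j (p.1 t), j v⟫ ∂(timeMeasure T) = ⟪p.1, hm.toLp _⟫ := fun p => by
      rw [L2.inner_def]
      refine integral_congr_ae ?_
      filter_upwards [hm.coeFn_toLp] with t ht
      rw [ht, real_inner_smul_right, ContinuousLinearMap.adjoint_inner_right]
    simp only [this]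
    fun_prop
  · have hm := hmem hφ.continuous hs v
    have : ∀ p : SpaceY V T × SpaceDualValued V T,
        ∫ t, φ t * p.2 t v ∂(timeMeasure T)
          = (ContinuousLinearMap.id ℝ (StrongDual ℝ V)).lpPairing (timeMeasure T) 2 2 p.2
            (hm.toLp _) := fun p => by
      rw [ContinuousLinearMap.lpPairing_eq_integral]
      refine integral_congr_ae ?_
      filter_upwards [hm.coeFn_toLp] with t ht
      simp [ht]
    simp only [this]
    fun_prop

theorem completeSpace_spaceX (j : V →L[ℝ] H) (T : ℝ) : CompleteSpace (SpaceX j T) :=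
  (isClosed_spaceX j T).completeSpace_coe

end TraceOperator

end

/-! ### Symmetric forms, the Riesz representation theorem and Galerkin quasi-optimality -/

noncomputable section

/-- The Riesz representation theorem for an inner product that induces the given topology of a
complete topological vector space. -/
theorem InnerProductSpace.Core.exists_inner_eq {E : Type*} [AddCommGroup E] [Module ℝ E]
    [uE : UniformSpace E] [IsUniformAddGroup E] [CompleteSpace E] [ContinuousConstSMul ℝ E]
    (cd : InnerProductSpace.Core ℝ E)
    (h : ContinuousAt (fun v : E => cd.inner v v) 0)
    (h' : Bornology.IsVonNBounded ℝ {v : E | RCLike.re (cd.inner v v) < 1})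
    (ℓ : E →L[ℝ] ℝ) : ∃ x, ∀ y, cd.inner x y = ℓ y := by
  let i1 : NormedAddCommGroup E := cd.toNormedAddCommGroupOfTopology h h'
  let i2 : InnerProductSpace ℝ E := InnerProductSpace.ofCoreOfTopology cd h h'
  have hu : uE = i1.toMetricSpace.toUniformSpace :=
    IsUniformAddGroup.ext ‹_› inferInstance rfl
  have i3 : @CompleteSpace E i1.toMetricSpace.toUniformSpace := by
    rw [← hu]; assumption
  exact ⟨(InnerProductSpace.toDual ℝ E).symm ℓ, fun y =>
    InnerProductSpace.toDual_symm_apply (x := y) (y := ℓ)⟩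

/-- The Riesz representation theorem for a symmetric coercive form on a Banach space. -/
theorem exists_equiv_dual_of_coercive {E : Type*} [NormedAddCommGroup E] [NormedSpace ℝ E]
    [CompleteSpace E] (b : E →L[ℝ] StrongDual ℝ E) (hs : ∀ x y, b x y = b y x) {c : ℝ} (hc : 0 < c)
    (hb : ∀ x, c * ‖x‖ ^ 2 ≤ b x x) :
    ∃ e : E ≃L[ℝ] StrongDual ℝ E, (e : E →L[ℝ] StrongDual ℝ E) = b := by
  have h0 : ∀ x, b x x = 0 → x = 0 := fun x hx => by
    have h1 := hb x
    rw [hx] at h1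
    have h2 : ‖x‖ ^ 2 = 0 := le_antisymm (by nlinarith) (sq_nonneg _)
    simpa using h2
  let cd : InnerProductSpace.Core ℝ E :=
    { inner := fun x y => b x y
      conj_inner_symm := fun x y => hs y x
      re_inner_nonneg := fun x => le_trans (by positivity) (hb x)
      add_left := fun x y z => by simp
      smul_left := fun x y r => by simp
      definite := h0 }
  have hcont : Continuous fun v : E => b v v := by fun_prop
  have hbdd : Bornology.IsVonNBounded ℝ {v : E | RCLike.re (cd.inner v v) < 1} := by
    rw [NormedSpace.isVonNBounded_iff]
    refine (Metric.isBounded_closedBall (x := (0 : E)) (r := √(1 / c))).subset fun v hv => ?_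
    have hv' : b v v < 1 := hv
    rw [mem_closedBall_zero_iff]
    refine Real.le_sqrt_of_sq_le ?_
    rw [le_div_iff₀ hc]
    linarith [hb v]
  have hsurj : Function.Surjective b := fun ℓ => by
    obtain ⟨x, hx⟩ := cd.exists_inner_eq hcont.continuousAt hbdd ℓ
    exact ⟨x, ContinuousLinearMap.ext hx⟩
  have hker : b.ker = ⊥ := LinearMap.ker_eq_bot'.2 fun x hx => h0 x (by
    have : b x = 0 := hx
    rw [this]; rfl)
  exact ⟨ContinuousLinearEquiv.ofBijective b hker (LinearMap.range_eq_top.2 hsurj),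
    ContinuousLinearEquiv.coe_ofBijective b hker _⟩

/-- The Cauchy-Schwarz inequality for a symmetric positive semidefinite form. -/
theorem LinearMap.sq_apply_le_of_nonneg {E : Type*} [AddCommGroup E] [Module ℝ E]
    (b : E →ₗ[ℝ] E →ₗ[ℝ] ℝ) (hs : ∀ x y, b x y = b y x) (hb : ∀ x, 0 ≤ b x x) (x y : E) :
    b x y ^ 2 ≤ b x x * b y y :=
  LinearMap.BilinForm.apply_sq_le_of_symm b hb ⟨hs⟩ x y

/-- A bounded operator into the dual, as a bilinear form. -/
def ContinuousLinearMap.toBilin {E : Type*} [NormedAddCommGroup E] [NormedSpace ℝ E]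
    (b : E →L[ℝ] StrongDual ℝ E) : E →ₗ[ℝ] E →ₗ[ℝ] ℝ :=
  ContinuousLinearMap.coeLM ℝ ∘ₗ (b : E →ₗ[ℝ] StrongDual ℝ E)

theorem ContinuousLinearMap.toBilin_apply {E : Type*} [NormedAddCommGroup E] [NormedSpace ℝ E]
    (b : E →L[ℝ] StrongDual ℝ E) (x y : E) : b.toBilin x y = b x y := rfl

/-- The dual norm of `f = b(x, ·)` with respect to the energy norm of a symmetric positive
definite form `b` is the energy norm of `x`. -/
theorem iSup_abs_div_sqrt_eq {E : Type*} [NormedAddCommGroup E] [NormedSpace ℝ E]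
    (b : E →L[ℝ] StrongDual ℝ E) (hs : ∀ x y, b x y = b y x) (hb : ∀ x, 0 ≤ b x x) (x : E) :
    ⨆ v, |b x v| / √(b v v) = √(b x x) := by
  have hcs : ∀ v, |b x v| ≤ √(b x x) * √(b v v) := fun v => by
    rw [← Real.sqrt_mul (hb x)]
    exact Real.abs_le_sqrt (b.toBilin.sq_apply_le_of_nonneg hs hb x v)
  have hle : ∀ v, |b x v| / √(b v v) ≤ √(b x x) := fun v =>
    div_le_of_le_mul₀ (Real.sqrt_nonneg _) (Real.sqrt_nonneg _) (hcs v)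
  refine le_antisymm (ciSup_le hle) ?_
  refine le_trans (le_of_eq ?_) (le_ciSup ⟨_, forall_mem_range.2 hle⟩ x)
  rw [abs_of_nonneg (hb x), Real.div_sqrt]

/-- Quasi-optimality of a Galerkin approximation from `Z` that uses a form `b ≤ s`. The point is
that the constant is not enlarged by `1`, which rests on the Cauchy-Schwarz inequality for
`s - b`. -/
theorem galerkin_quasi_optimal {E : Type*} [AddCommGroup E] [Module ℝ E]
    (s b : E →ₗ[ℝ] E →ₗ[ℝ] ℝ) (hss : ∀ x y, s x y = s y x) (hbs : ∀ x y, b x y = b y x)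
    (hb0 : ∀ x, 0 ≤ b x x) (hble : ∀ x, b x x ≤ s x x) {κ : ℝ} {e z : E}
    (hκ1 : κ ≤ 1) (hez : b e z = 0) (hz : κ * s z z ≤ b z z) :
    κ * s e e ≤ s (e - z) (e - z) := by
  have hcs := LinearMap.sq_apply_le_of_nonneg (s - b)
    (fun x y => by simp only [LinearMap.sub_apply, hss x y, hbs x y])
    (fun x => by simpa using hble x) e z
  simp only [LinearMap.sub_apply, hez, sub_zero] at hcs
  have hse : 0 ≤ s e e := (hb0 e).trans (hble e)
  have hsz : 0 ≤ s z z := (hb0 z).trans (hble z)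
  have h1 : s e z ^ 2 ≤ s e e * ((1 - κ) * s z z) :=
    hcs.trans (mul_le_mul (by linarith [hb0 e]) (by linarith) (by linarith [hble z]) hse)
  have h2 : s (e - z) (e - z) = s e e - 2 * s e z + s z z := by
    simp only [map_sub, LinearMap.sub_apply, hss z e]
    ring
  rw [h2]
  -- `2 |s(e, z)| ≤ (1 - κ) s(e, e) + s(z, z)` by the arithmetic-geometric mean inequality.
  have h3 : (2 * s e z) ^ 2 ≤ ((1 - κ) * s e e + s z z) ^ 2 := by
    nlinarith [sq_nonneg ((1 - κ) * s e e - s z z)]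
  have h4 := abs_le_of_sq_le_sq h3 (by
    have := mul_nonneg (sub_nonneg.2 hκ1) hse
    linarith)
  linarith [le_abs_self (2 * s e z)]

end

/-! ### Dual norms of symmetric coercive forms and Galerkin error bounds -/

noncomputable section

section CoerciveForm

variable {E : Type*} [NormedAddCommGroup E] [NormedSpace ℝ E]

theorem exists_norm_apply_le (b : E →L[ℝ] StrongDual ℝ E) :
    ∃ M : ℝ, ∀ x, ‖b x‖ ≤ M * ‖x‖ := ⟨‖b‖, b.le_opNorm⟩

/-- A symmetric and coercive bounded bilinear form. -/
structure IsSymmCoercive (b : E →L[ℝ] StrongDual ℝ E) : Prop where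
  symm : ∀ x y, b x y = b y x
  coercive : ∃ c : ℝ, 0 < c ∧ ∀ x, c * ‖x‖ ^ 2 ≤ b x x

namespace IsSymmCoercive

variable {b : E →L[ℝ] StrongDual ℝ E} (hb : IsSymmCoercive b)
include hb

theorem nonneg (x : E) : 0 ≤ b x x := by
  obtain ⟨c, hc, h⟩ := hb.coercive
  exact le_trans (by positivity) (h x)

theorem sq_apply_le (x y : E) : b x y ^ 2 ≤ b x x * b y y :=
  b.toBilin.sq_apply_le_of_nonneg hb.symm hb.nonneg x y

theorem restrict (F : Submodule ℝ E) : IsSymmCoercive (b.bilinearComp F.subtypeL F.subtypeL) := by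
  obtain ⟨c, hc, h⟩ := hb.coercive
  exact ⟨fun x y => hb.symm x y, c, hc, fun x => h x⟩

variable [CompleteSpace E]

/-- A symmetric coercive form is boundedly invertible, so that `ContinuousLinearMap.inverse` is its
genuine inverse. -/
theorem inverse_spec :
    (∀ f, b (b.inverse f) = f) ∧ ∀ x, b.inverse (b x) = x := by
  obtain ⟨c, hc, h⟩ := hb.coercive
  obtain ⟨e, he⟩ := exists_equiv_dual_of_coercive b hb.symm hc h
  rw [← he, ContinuousLinearMap.inverse_equiv]
  exact ⟨fun f => e.apply_symm_apply f, fun x => e.symm_apply_apply x⟩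

theorem apply_inverse (f : StrongDual ℝ E) : b (b.inverse f) = f := hb.inverse_spec.1 f

theorem inverse_apply (x : E) : b.inverse (b x) = x := hb.inverse_spec.2 x

theorem inverse_symm (f h : StrongDual ℝ E) : f (b.inverse h) = h (b.inverse f) := by
  conv_lhs => rw [← hb.apply_inverse f]
  conv_rhs => rw [← hb.apply_inverse h]
  exact hb.symm _ _

theorem apply_inverse_self_eq (f : StrongDual ℝ E) :
    f (b.inverse f) = b (b.inverse f) (b.inverse f) := by
  rw [hb.apply_inverse]

theorem inverse_nonneg (f : StrongDual ℝ E) : 0 ≤ f (b.inverse f) := by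
  rw [hb.apply_inverse_self_eq]
  exact hb.nonneg _

theorem iSup_eq_sqrt_inverse (f : StrongDual ℝ E) :
    ⨆ v, |f v| / √(b v v) = √(f (b.inverse f)) := by
  have h := iSup_abs_div_sqrt_eq b hb.symm hb.nonneg (b.inverse f)
  rwa [hb.apply_inverse] at h

theorem sq_apply_le_inverse_mul (f : StrongDual ℝ E) (v : E) :
    f v ^ 2 ≤ f (b.inverse f) * b v v := by
  have h := hb.sq_apply_le (b.inverse f) v
  rwa [hb.apply_inverse] at h

/-- The dual norm of the energy norm dominates the operator norm. -/
theorem exists_norm_sq_le_inverse :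
    ∃ L : ℝ, 0 < L ∧ ∀ f : StrongDual ℝ E, ‖f‖ ^ 2 ≤ L * f (b.inverse f) := by
  refine ⟨‖b‖ + 1, by positivity, fun f => ?_⟩
  have hN := hb.inverse_nonneg f
  have h : ‖f‖ ≤ √((‖b‖ + 1) * f (b.inverse f)) := by
    refine f.opNorm_le_bound (Real.sqrt_nonneg _) fun v => ?_
    refine le_of_sq_le_sq ?_ (by positivity)
    rw [mul_pow, Real.sq_sqrt (by positivity), Real.norm_eq_abs, sq_abs]
    refine (hb.sq_apply_le_inverse_mul f v).trans ?_
    have h1 : b v v ≤ ‖b‖ * ‖v‖ * ‖v‖ := (le_abs_self _).trans (b.le_opNorm₂ v v)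
    nlinarith [mul_le_mul_of_nonneg_left h1 hN, mul_nonneg hN (sq_nonneg ‖v‖)]
  calc ‖f‖ ^ 2 ≤ √((‖b‖ + 1) * f (b.inverse f)) ^ 2 := by gcongr
    _ = _ := Real.sq_sqrt (by positivity)

/-- Expansion of the square of the dual norm of `f + b(y, ·)`. -/
theorem inverse_add (f : StrongDual ℝ E) (y : E) :
    (f + b y) (b.inverse (f + b y)) = f (b.inverse f) + 2 * f y + b y y := by
  have h : b y (b.inverse f) = f y := by rw [hb.symm, hb.apply_inverse]
  rw [map_add, hb.inverse_apply]
  simp only [add_apply, map_add, h]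
  ring

/-- Restricting a functional to a subspace does not increase its dual norm. -/
theorem restrict_inverse_le {F : Submodule ℝ E} [CompleteSpace F] (f : StrongDual ℝ E) :
    f ((b.bilinearComp F.subtypeL F.subtypeL).inverse (f.comp F.subtypeL) : F)
      ≤ f (b.inverse f) := by
  have hF := hb.restrict F
  set p : F := (b.bilinearComp F.subtypeL F.subtypeL).inverse (f.comp F.subtypeL) with hp
  have h1 : b (p : E) (p : E) = f p := by
    have := hF.apply_inverse_self_eq (f.comp F.subtypeL)
    exact this.symm
  have h2 := hb.sq_apply_le_inverse_mul f p
  have h3 := hb.nonneg (p : E)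
  rw [h1] at h2 h3
  rcases h3.eq_or_lt with h | h
  · rw [← h]; exact hb.inverse_nonneg f
  · rw [sq] at h2; exact le_of_mul_le_mul_right h2 h

theorem existsUnique_solution {ℓ : StrongDual ℝ E} : ∃! x, ∀ z, b x z = ℓ z := by
  refine ⟨b.inverse ℓ, fun z => by rw [hb.apply_inverse], fun y hy => ?_⟩
  rw [← ContinuousLinearMap.ext hy, hb.inverse_apply]

end IsSymmCoercive

/-- Unique solvability of a Galerkin system on a closed subspace. -/
theorem existsUnique_galerkin [CompleteSpace E] (b : E →L[ℝ] StrongDual ℝ E)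
    (hs : ∀ x y, b x y = b y x) {Z : Submodule ℝ E} (hZ : IsClosed (Z : Set E)) {c : ℝ}
    (hc : 0 < c) (hb : ∀ z ∈ Z, c * ‖z‖ ^ 2 ≤ b z z) (ℓ : StrongDual ℝ E) :
    ∃! x, x ∈ Z ∧ ∀ z ∈ Z, b x z = ℓ z := by
  have : CompleteSpace Z := hZ.completeSpace_coe
  have hbZ : IsSymmCoercive (b.bilinearComp Z.subtypeL Z.subtypeL) :=
    ⟨fun x y => hs x y, c, hc, fun x => hb x x.2⟩
  obtain ⟨x, hx, hu⟩ := hbZ.existsUnique_solution (ℓ := ℓ.comp Z.subtypeL)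
  refine ⟨x, ⟨x.2, fun z hz => hx ⟨z, hz⟩⟩, fun y hy => ?_⟩
  exact congrArg Subtype.val (hu ⟨y, hy.1⟩ fun z => hy.2 z z.2)

/-- Two-sided comparison of the dual norms of two spectrally equivalent forms. -/
theorem IsSymmCoercive.compare_inverse [CompleteSpace E] {b : E →L[ℝ] StrongDual ℝ E}
    (hb : IsSymmCoercive b) (K : StrongDual ℝ E ≃L[ℝ] E) (hK : ∀ f h : StrongDual ℝ E,
      f (K h) = h (K f)) {r R : ℝ} (hr : 0 < r)
    (hKr : ∀ v, r * b v v ≤ K.symm v v) (hKR : ∀ v, K.symm v v ≤ R * b v v)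
    (f : StrongDual ℝ E) :
    0 ≤ f (K f) ∧ r * f (K f) ≤ f (b.inverse f) ∧ f (b.inverse f) ≤ R * f (K f) := by
  have hK0 : ∀ v, 0 ≤ K.symm v v := fun v =>
    (mul_nonneg hr.le (hb.nonneg v)).trans (hKr v)
  have hKs : ∀ v w, K.symm v w = K.symm w v := fun v w => by
    have := hK (K.symm v) (K.symm w)
    simpa using this
  have hp : 0 ≤ f (K f) := by simpa using hK0 (K f)
  have hN := hb.inverse_nonneg f
  refine ⟨hp, ?_, ?_⟩
  · have h1 := hb.sq_apply_le_inverse_mul f (K f)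
    have h2 := hKr (K f)
    simp only [ContinuousLinearEquiv.symm_apply_apply] at h2
    rcases hp.eq_or_lt with h | h
    · rw [← h]; simpa using hN
    · refine le_of_mul_le_mul_right ?_ h
      nlinarith [mul_le_mul_of_nonneg_left h2 hN]
  · have h1 := LinearMap.sq_apply_le_of_nonneg
      (K.symm : E →L[ℝ] StrongDual ℝ E).toBilin hKs hK0 (K f) (b.inverse f)
    have h1' : f (b.inverse f) ^ 2
        ≤ f (K f) * K.symm (b.inverse f) (b.inverse f) := by
      simpa [ContinuousLinearMap.toBilin_apply] using h1
    have h2 := hKR (b.inverse f)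
    rw [← hb.apply_inverse_self_eq] at h2
    rcases hN.eq_or_lt with h | h
    · rw [← h]
      have h4 := hb.sq_apply_le_inverse_mul f (K f)
      rw [← h, zero_mul] at h4
      have h5 : f (K f) = 0 := by nlinarith [sq_nonneg (f (K f))]
      rw [h5, mul_zero]
    · refine le_of_mul_le_mul_right ?_ h
      nlinarith [mul_le_mul_of_nonneg_left h2 hp]

/-- The triangle inequality for the seminorm of a semidefinite form. -/
theorem LinearMap.sqrt_apply_add_le {E : Type*} [AddCommGroup E] [Module ℝ E]
    (s : E →ₗ[ℝ] E →ₗ[ℝ] ℝ) (hs : ∀ x y, s x y = s y x) (h0 : ∀ x, 0 ≤ s x x) (x y : E) :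
    √(s (x + y) (x + y)) ≤ √(s x x) + √(s y y) := by
  refine Real.sqrt_le_iff.2 ⟨by positivity, ?_⟩
  have h1 := Real.abs_le_sqrt (s.sq_apply_le_of_nonneg hs h0 x y)
  rw [Real.sqrt_mul (h0 x)] at h1
  have h2 := le_abs_self (s x y)
  rw [add_sq, Real.sq_sqrt (h0 x), Real.sq_sqrt (h0 y)]
  simp only [map_add, LinearMap.add_apply, hs y x]
  linarith

/-- Quasi-optimality of a Galerkin method whose form `m` satisfies `ρ m ≤ s` everywhere and
`γ² s ≤ P m` on the trial space. -/
theorem galerkin_error_le_of_equivalent {E : Type*} [AddCommGroup E] [Module ℝ E]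
    (s m : E →ₗ[ℝ] E →ₗ[ℝ] ℝ) (hss : ∀ x y, s x y = s y x) (hms : ∀ x y, m x y = m y x)
    (hm0 : ∀ x, 0 ≤ m x x) {ρ P γ : ℝ} (hρ : 0 < ρ) (hρP : ρ ≤ P) (hγ : 0 < γ) (hγ1 : γ ≤ 1)
    (hup : ∀ x, ρ * m x x ≤ s x x)
    {Z : Submodule ℝ E} (hlow : ∀ z ∈ Z, γ ^ 2 * s z z ≤ P * m z z) {u x w : E}
    (hx : x ∈ Z) (hw : w ∈ Z) (hxz : ∀ z ∈ Z, m (u - x) z = 0) :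
    √(s (u - x) (u - x)) ≤ √(P / ρ) * γ⁻¹ * √(s (u - w) (u - w)) := by
  have hP : 0 < P := hρ.trans_le hρP
  have hκ : ρ / P * γ ^ 2 ≤ 1 :=
    mul_le_one₀ ((div_le_one hP).2 hρP) (sq_nonneg γ) (pow_le_one₀ hγ.le hγ1)
  have hwx : w - x ∈ Z := Z.sub_mem hw hx
  have hq := galerkin_quasi_optimal s (ρ • m) hss
    (fun x y => by simp only [LinearMap.smul_apply, hms x y])
    (fun x => mul_nonneg hρ.le (hm0 x)) hup (e := u - x) (z := w - x) hκ
    (by simp only [LinearMap.smul_apply, hxz _ hwx, smul_zero])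
    (by
      have := hlow _ hwx
      simp only [LinearMap.smul_apply, smul_eq_mul]
      rw [div_mul_eq_mul_div, div_mul_eq_mul_div, div_le_iff₀ hP]
      nlinarith [mul_le_mul_of_nonneg_left this hρ.le])
  rw [sub_sub_sub_cancel_right] at hq
  have h1 : s (u - x) (u - x) ≤ P / ρ * (γ⁻¹) ^ 2 * s (u - w) (u - w) := by
    have h2 : P / ρ * (γ⁻¹) ^ 2 * (ρ / P * γ ^ 2 * s (u - x) (u - x))
        = s (u - x) (u - x) := by
      field_simp
    rw [← h2]
    exact mul_le_mul_of_nonneg_left hq (by positivity)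
  refine (Real.sqrt_le_sqrt h1).trans (le_of_eq ?_)
  rw [Real.sqrt_mul (by positivity), Real.sqrt_mul (by positivity),
    Real.sqrt_sq (by positivity)]

/-- Error bound for a Galerkin method with inconsistent load: `y` is the consistent Galerkin
approximation of `u`, and `n` measures the consistency error of the computed approximation `x`. -/
theorem galerkin_error_le_of_consistency {E : Type*} [AddCommGroup E] [Module ℝ E]
    (s b : E →ₗ[ℝ] E →ₗ[ℝ] ℝ) (hss : ∀ x y, s x y = s y x) (hbs : ∀ x y, b x y = b y x)
    (hb0 : ∀ x, 0 ≤ b x x) (hble : ∀ x, b x x ≤ s x x) {γ n : ℝ} (hγ : 0 < γ) (hγ1 : γ ≤ 1)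
    {Z : Submodule ℝ E} (hlow : ∀ z ∈ Z, γ ^ 2 * s z z ≤ b z z) {u x y w : E}
    (hy : y ∈ Z) (hx : x ∈ Z) (hw : w ∈ Z) (hyz : ∀ z ∈ Z, b (u - y) z = 0) (hn : 0 ≤ n)
    (hq : b (y - x) (y - x) ≤ √(s (y - x) (y - x)) * n) :
    √(s (u - x) (u - x)) ≤ (γ⁻¹) ^ 2 * (√(s (u - w) (u - w)) + n) := by
  have hs0 : ∀ x, 0 ≤ s x x := fun x => (hb0 x).trans (hble x)
  have hopt := galerkin_quasi_optimal s b hss hbs hb0 hble (pow_le_one₀ hγ.le hγ1)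
    (hyz (w - y) (Z.sub_mem hw hy)) (hlow _ (Z.sub_mem hw hy))
  rw [sub_sub_sub_cancel_right] at hopt
  have h1 : γ * √(s (u - y) (u - y)) ≤ √(s (u - w) (u - w)) := by
    have := Real.sqrt_le_sqrt hopt
    rwa [Real.sqrt_mul (by positivity), Real.sqrt_sq hγ.le] at this
  have hlq := hlow _ (Z.sub_mem hy hx)
  have htri := s.sqrt_apply_add_le hss hs0 (u - y) (y - x)
  rw [sub_add_sub_cancel] at htri
  have h2 : γ ^ 2 * √(s (y - x) (y - x)) ≤ n := by
    rcases (Real.sqrt_nonneg (s (y - x) (y - x))).eq_or_lt with h | h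
    · rw [← h, mul_zero]; exact hn
    · refine le_of_mul_le_mul_right ?_ h
      rw [mul_assoc, Real.mul_self_sqrt (hs0 _), mul_comm n]
      exact hlq.trans hq
  rw [inv_pow, ← div_eq_inv_mul, le_div_iff₀ (by positivity)]
  have h3 : γ ^ 2 * √(s (u - y) (u - y)) ≤ γ * √(s (u - y) (u - y)) :=
    mul_le_mul_of_nonneg_right (by nlinarith) (Real.sqrt_nonneg _)
  have h4 := mul_le_mul_of_nonneg_left htri (sq_nonneg γ)
  linarith

end CoerciveForm

end

/-! ### The energy inner product on `X` -/

noncomputable section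

section EnergyForms

variable {V H : Type*} [NormedAddCommGroup V] [InnerProductSpace ℝ V]
  [NormedAddCommGroup H] [InnerProductSpace ℝ H] {j : V →L[ℝ] H} {T : ℝ}

/-- The inner product `⟪γ w, γ z⟫` pulled back along a bounded operator `γ`. -/
def innerPullback {X : Type*} [NormedAddCommGroup X] [NormedSpace ℝ X] (γ : X →L[ℝ] H) :
    X →L[ℝ] StrongDual ℝ X :=
  ((innerₗ H).mkContinuous₂ 1 fun x y => by
    simpa using norm_inner_le_norm (𝕜 := ℝ) x y).bilinearComp γ γ

/-- The form `(w, z) ↦ (L z)(K (L w))` obtained from an operator `L` into the dual of a subspace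
`F` and an operator `K : F' → F`. -/
def dualPullback {X F : Type*} [NormedAddCommGroup X] [NormedSpace ℝ X] [NormedAddCommGroup F]
    [NormedSpace ℝ F] (K : StrongDual ℝ F →L[ℝ] F) (L : X →L[ℝ] StrongDual ℝ F) :
    X →L[ℝ] StrongDual ℝ X :=
  ((NormedSpace.inclusionInDoubleDual ℝ F).comp K).bilinearComp L L

/-- The restriction of functionals to a subspace as a bounded operator. -/
def restrictL {E : Type*} [NormedAddCommGroup E] [NormedSpace ℝ E] (F : Submodule ℝ E) :
    StrongDual ℝ E →L[ℝ] StrongDual ℝ F :=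
  (ContinuousLinearMap.compL ℝ F E ℝ).flip F.subtypeL

namespace ParabolicForm

variable (a : ParabolicForm V T)

theorem opAs_apply (w v : SpaceY V T) : a.opAs w v = 2⁻¹ * (a.opA w v + a.opA v w) := by
  simp [opAs, mul_add]

theorem opAa_apply (w v : SpaceY V T) : a.opAa w v = 2⁻¹ * (a.opA w v - a.opA v w) := by
  simp [opAa]

theorem opAa_self (v : SpaceY V T) : a.opAa v v = 0 := by simp [opAa_apply]

theorem isSymmCoercive_opAs : IsSymmCoercive a.opAs := by
  obtain ⟨c, hc, h⟩ := a.coercive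
  refine ⟨fun x y => by rw [opAs_apply, opAs_apply, add_comm], c, hc, fun v => ?_⟩
  have h1 : a.opAs v v = ∫ t, a.form t (v t) (v t) ∂(timeMeasure T) := by
    rw [opAs_apply, ← opA_apply]; ring
  rw [h1, ← real_inner_self_eq_norm_sq, L2.inner_def, ← integral_const_mul]
  refine integral_mono_ae ((L2.integrable_inner v v).const_mul c) (a.integrable_comp v v) ?_
  filter_upwards [h] with t ht
  rw [real_inner_self_eq_norm_sq]
  exact ht _

theorem opB_eq (w : SpaceX j T) : a.opB w = a.opC w + a.opAs (embY w) := by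
  ext v
  simp only [opB, opC, add_apply, ContinuousLinearMap.comp_apply, opAs_apply, opAa_apply]
  ring

theorem normY_sq (v : SpaceY V T) : a.normY v ^ 2 = a.opAs v v :=
  Real.sq_sqrt (a.isSymmCoercive_opAs.nonneg v)

variable [CompleteSpace V]

theorem normYDual_sq (f : StrongDual ℝ (SpaceY V T)) :
    a.normYDual f ^ 2 = f (a.opAs.inverse f) := by
  have h := a.isSymmCoercive_opAs
  have h1 : a.normYDual f = √(f (a.opAs.inverse f)) := h.iSup_eq_sqrt_inverse f
  rw [h1, Real.sq_sqrt (h.inverse_nonneg f)]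

omit [CompleteSpace V] in
theorem isSymmCoercive_opAsOn (F : Submodule ℝ (SpaceY V T)) : IsSymmCoercive (a.opAsOn F) :=
  a.isSymmCoercive_opAs.restrict F

omit [CompleteSpace V] in
theorem dualNorm_sq (F : Submodule ℝ (SpaceY V T)) [CompleteSpace F] (f : StrongDual ℝ F) :
    a.dualNorm F f ^ 2 = f ((a.opAsOn F).inverse f) := by
  have h := a.isSymmCoercive_opAsOn F
  have h1 : a.dualNorm F f = √(f ((a.opAsOn F).inverse f)) := h.iSup_eq_sqrt_inverse f
  rw [h1, Real.sq_sqrt (h.inverse_nonneg f)]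

omit [CompleteSpace V] in
theorem dualNorm_nonneg (F : Submodule ℝ (SpaceY V T)) (f : StrongDual ℝ F) :
    0 ≤ a.dualNorm F f :=
  Real.iSup_nonneg fun _ => div_nonneg (abs_nonneg _) (Real.sqrt_nonneg _)

omit [CompleteSpace V] in
theorem normYDual_nonneg (f : StrongDual ℝ (SpaceY V T)) : 0 ≤ a.normYDual f :=
  Real.iSup_nonneg fun _ => div_nonneg (abs_nonneg _) (Real.sqrt_nonneg _)

omit [CompleteSpace V] in
theorem gammaC_le_of_mem {Δ : Type*} {Xd : Δ → Submodule ℝ (SpaceX j T)}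
    {Yd : Δ → Submodule ℝ (SpaceY V T)} {q : ℝ}
    (hq : q ∈ insert 1 {q : ℝ | ∃ δ : Δ, ∃ w ∈ Xd δ, a.opC w ≠ 0 ∧
      q = a.dualNorm (Yd δ) (restrictDual (Yd δ) (a.opC w)) / a.normYDual (a.opC w)}) :
    a.gammaC Xd Yd ≤ q := by
  refine csInf_le ⟨0, ?_⟩ hq
  rintro q (rfl | ⟨δ, w, -, -, rfl⟩)
  · exact zero_le_one
  · exact div_nonneg (a.dualNorm_nonneg _ _) (a.normYDual_nonneg _)

omit [CompleteSpace V] in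
theorem gammaC_le_one {Δ : Type*} (Xd : Δ → Submodule ℝ (SpaceX j T))
    (Yd : Δ → Submodule ℝ (SpaceY V T)) : a.gammaC Xd Yd ≤ 1 :=
  a.gammaC_le_of_mem (mem_insert _ _)

/-- The inf-sup condition in terms of squared dual norms. It holds also if `C w = 0`, which
`gammaC` excludes. -/
theorem gammaC_sq_mul_le {Δ : Type*} {Xd : Δ → Submodule ℝ (SpaceX j T)}
    {Yd : Δ → Submodule ℝ (SpaceY V T)} (hγ : 0 < a.gammaC Xd Yd) (δ : Δ)
    [CompleteSpace (Yd δ)] {w : SpaceX j T} (hw : w ∈ Xd δ) :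
    a.gammaC Xd Yd ^ 2 * a.opC w (a.opAs.inverse (a.opC w))
      ≤ restrictDual (Yd δ) (a.opC w)
        ((a.opAsOn (Yd δ)).inverse (restrictDual (Yd δ) (a.opC w))) := by
  rw [← a.normYDual_sq, ← a.dualNorm_sq (Yd δ)]
  rcases (a.normYDual_nonneg (a.opC w)).eq_or_lt with h | h
  · rw [← h]
    simpa using sq_nonneg _
  · have hne : a.opC w ≠ 0 := by
      rintro h0
      have h2 := a.normYDual_sq (a.opC w)
      rw [h0] at h2 h
      simp only [zero_apply] at h2
      exact h.ne' (by simpa using h2)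
    have hle := a.gammaC_le_of_mem (Yd := Yd) (mem_insert_of_mem _ ⟨δ, w, hw, hne, rfl⟩)
    rw [le_div_iff₀ h] at hle
    rw [← mul_pow]
    exact pow_le_pow_left₀ (by positivity) hle 2

/-- The inner product on `X` whose norm is the energy norm, for `γ₀` the trace operator at `0`.
The trace operators enter as parameters, because `trace` is not bundled as a bounded operator. -/
def energyForm (β : ℝ) (γ₀ : SpaceX j T →L[ℝ] H) : SpaceX j T →L[ℝ] StrongDual ℝ (SpaceX j T) :=
  dualPullback a.opAs.inverse a.opB + β • innerPullback γ₀

omit [CompleteSpace V] in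
theorem energyForm_apply (β : ℝ) (γ₀ : SpaceX j T →L[ℝ] H) (w z : SpaceX j T) :
    a.energyForm β γ₀ w z = a.opB z (a.opAs.inverse (a.opB w)) + β * ⟪γ₀ w, γ₀ z⟫ := rfl

theorem energyForm_symm (β : ℝ) (γ₀ : SpaceX j T →L[ℝ] H) (w z : SpaceX j T) :
    a.energyForm β γ₀ w z = a.energyForm β γ₀ z w := by
  rw [energyForm_apply, energyForm_apply, a.isSymmCoercive_opAs.inverse_symm, real_inner_comm]

theorem energyForm_nonneg {β : ℝ} (hβ : 0 ≤ β) (γ₀ : SpaceX j T →L[ℝ] H) (w : SpaceX j T) :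
    0 ≤ a.energyForm β γ₀ w w := by
  rw [energyForm_apply, real_inner_self_eq_norm_sq]
  have := a.isSymmCoercive_opAs.inverse_nonneg (a.opB w)
  positivity

theorem energyNormX_eq (β : ℝ) {γ₀ : SpaceX j T →L[ℝ] H} (h0 : ∀ w, γ₀ w = trace 0 w)
    (w : SpaceX j T) : a.energyNormX β w = √(a.energyForm β γ₀ w w) := by
  rw [energyNormX, a.normYDual_sq, energyForm_apply, h0, real_inner_self_eq_norm_sq]

omit [CompleteSpace V] in
/-- By integration by parts in time, the skew-symmetric operator `C = ∂_t + A_a` satisfies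
`(C w)(w) = (‖w(T)‖² - ‖w(0)‖²) / 2`. -/
theorem two_mul_opC_self {γ₀ γT : SpaceX j T →L[ℝ] H}
    (hibp : ∀ w z : SpaceX j T, opDt w (embY z) + opDt z (embY w)
      = ⟪γT w, γT z⟫ - ⟪γ₀ w, γ₀ z⟫) (w : SpaceX j T) :
    2 * a.opC w (embY w) = ‖γT w‖ ^ 2 - ‖γ₀ w‖ ^ 2 := by
  have h := hibp w w
  rw [real_inner_self_eq_norm_sq, real_inner_self_eq_norm_sq] at h
  simp only [opC, add_apply, ContinuousLinearMap.comp_apply, opAa_self]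
  linarith

/-- The energy norm in terms of `C` and the traces at both end points. -/
theorem energyForm_self_eq (β : ℝ) {γ₀ γT : SpaceX j T →L[ℝ] H}
    (hibp : ∀ w z : SpaceX j T, opDt w (embY z) + opDt z (embY w)
      = ⟪γT w, γT z⟫ - ⟪γ₀ w, γ₀ z⟫) (w : SpaceX j T) :
    a.energyForm β γ₀ w w = a.opC w (a.opAs.inverse (a.opC w)) + a.opAs (embY w) (embY w)
      + ‖γT w‖ ^ 2 + (β - 1) * ‖γ₀ w‖ ^ 2 := by
  rw [energyForm_apply, opB_eq, a.isSymmCoercive_opAs.inverse_add, real_inner_self_eq_norm_sq,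
    a.two_mul_opC_self hibp]
  ring

/-- The energy norm dominates the norm of `X`: `‖∂_t w‖` is bounded by `‖C w‖_{Y'}` and
`‖A_a‖ ‖w‖_Y`. -/
theorem exists_coercive_energy (hd : ∀ w : SpaceX j T, ‖weakDt w‖ ≤ ‖opDt w‖) :
    ∃ c : ℝ, 0 < c ∧ ∀ w : SpaceX j T, c * ‖w‖ ^ 2
      ≤ a.opC w (a.opAs.inverse (a.opC w)) + a.opAs (embY w) (embY w) := by
  have hs := a.isSymmCoercive_opAs
  obtain ⟨c, hc, h⟩ := hs.coercive
  obtain ⟨α, hα⟩ := exists_norm_apply_le a.opAa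
  obtain ⟨L, hL, hLN⟩ := hs.exists_norm_sq_le_inverse
  set M := 2 * L + (1 + 2 * α ^ 2) / c with hM
  have hM0 : 0 < M := by positivity
  refine ⟨1 / M, by positivity, fun w => ?_⟩
  set N := a.opC w (a.opAs.inverse (a.opC w))
  have hN : 0 ≤ N := hs.inverse_nonneg _
  have hq := h (embY w)
  set q := a.opAs (embY w) (embY w)
  have hq0 : 0 ≤ q := hs.nonneg _
  have h1 : ‖a.opC w‖ ^ 2 ≤ L * N := hLN _
  have h2 : ‖weakDt w‖ ≤ ‖a.opC w‖ + α * ‖embY w‖ := by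
    have h : opDt w = a.opC w - a.opAa (embY w) := by simp [opC]
    refine (hd w).trans ?_
    rw [h]
    have h' := norm_sub_le (a.opC w) (a.opAa (embY w))
    linarith [hα (embY w)]
  have h3 : ‖w‖ ^ 2 ≤ ‖embY w‖ ^ 2 + ‖weakDt w‖ ^ 2 := by
    have : ‖w‖ = max ‖embY w‖ ‖weakDt w‖ := rfl
    rw [this]
    rcases max_choice ‖embY w‖ ‖weakDt w‖ with h | h <;> rw [h] <;>
      nlinarith [sq_nonneg ‖embY w‖, sq_nonneg ‖weakDt w‖]
  have h4 : ‖weakDt w‖ ^ 2 ≤ 2 * ‖a.opC w‖ ^ 2 + 2 * (α * ‖embY w‖) ^ 2 := by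
    have := pow_le_pow_left₀ (norm_nonneg _) h2 2
    nlinarith [sq_nonneg (‖a.opC w‖ - α * ‖embY w‖)]
  have h5 : ‖embY w‖ ^ 2 ≤ q / c := by rw [le_div_iff₀ hc]; linarith
  rw [one_div, inv_mul_le_iff₀ hM0]
  calc ‖w‖ ^ 2 ≤ (1 + 2 * α ^ 2) * ‖embY w‖ ^ 2 + 2 * (L * N) := by nlinarith
    _ ≤ (1 + 2 * α ^ 2) * (q / c) + 2 * (L * N) := by gcongr
    _ ≤ M * (N + q) := by
      have e1 : 0 ≤ 2 * L * q := by positivity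
      have e2 : 0 ≤ (1 + 2 * α ^ 2) / c * N := by positivity
      have e3 : (1 + 2 * α ^ 2) * (q / c) = (1 + 2 * α ^ 2) / c * q := by ring
      rw [hM, e3]
      nlinarith

end ParabolicForm

end EnergyForms

end

/-! ### The minimal residual and Brézis-Ekeland-Nayroles forms -/

noncomputable section

section Galerkin

variable {V H : Type*} [NormedAddCommGroup V] [InnerProductSpace ℝ V] [CompleteSpace V]
  [NormedAddCommGroup H] [InnerProductSpace ℝ H] {j : V →L[ℝ] H} {T : ℝ}

namespace ParabolicForm

variable (a : ParabolicForm V T)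

/-- The bilinear form of the minimal residual system. -/
def mrForm (β : ℝ) (F : Submodule ℝ (SpaceY V T)) (K : StrongDual ℝ F →L[ℝ] F)
    (γ₀ : SpaceX j T →L[ℝ] H) : SpaceX j T →L[ℝ] StrongDual ℝ (SpaceX j T) :=
  dualPullback K ((restrictL F).comp a.opB) + β • innerPullback γ₀

omit [CompleteSpace V] in
theorem mrForm_apply (β : ℝ) (F : Submodule ℝ (SpaceY V T)) (K : StrongDual ℝ F →L[ℝ] F)
    (γ₀ : SpaceX j T →L[ℝ] H) (w z : SpaceX j T) :
    a.mrForm β F K γ₀ w z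
      = a.opB z (K (restrictDual F (a.opB w)) : SpaceY V T) + β * ⟪γ₀ w, γ₀ z⟫ := rfl

/-- The bilinear form of the Brézis-Ekeland-Nayroles system. -/
def benForm (β : ℝ) (F : Submodule ℝ (SpaceY V T)) (γ₀ γT : SpaceX j T →L[ℝ] H) :
    SpaceX j T →L[ℝ] StrongDual ℝ (SpaceX j T) :=
  dualPullback (a.opAsOn F).inverse ((restrictL F).comp a.opC)
    + a.opAs.bilinearComp embY embY + innerPullback γT + (β - 1) • innerPullback γ₀

omit [CompleteSpace V] in
theorem benForm_apply (β : ℝ) (F : Submodule ℝ (SpaceY V T)) (γ₀ γT : SpaceX j T →L[ℝ] H)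
    (w z : SpaceX j T) :
    a.benForm β F γ₀ γT w z
      = a.opC z ((a.opAsOn F).inverse (restrictDual F (a.opC w)) : SpaceY V T)
        + a.opAs (embY w) (embY z) + ⟪γT w, γT z⟫ + (β - 1) * ⟪γ₀ w, γ₀ z⟫ := rfl

variable {Δ : Type*} {Xd : Δ → Submodule ℝ (SpaceX j T)} {Yd : Δ → Submodule ℝ (SpaceY V T)}
  {β : ℝ} {γ₀ γT : SpaceX j T →L[ℝ] H}

omit [CompleteSpace V] in
theorem benForm_symm (F : Submodule ℝ (SpaceY V T)) [CompleteSpace F] (w z : SpaceX j T) :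
    a.benForm β F γ₀ γT w z = a.benForm β F γ₀ γT z w := by
  have h := (a.isSymmCoercive_opAsOn F).inverse_symm (restrictDual F (a.opC z))
    (restrictDual F (a.opC w))
  have h' : a.opC z ((a.opAsOn F).inverse (restrictDual F (a.opC w)) : SpaceY V T)
    = a.opC w ((a.opAsOn F).inverse (restrictDual F (a.opC z)) : SpaceY V T) := h
  rw [benForm_apply, benForm_apply, h', a.isSymmCoercive_opAs.symm, real_inner_comm,
    real_inner_comm (γ₀ z)]

theorem benForm_le_energyForm (F : Submodule ℝ (SpaceY V T)) [CompleteSpace F]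
    (hibp : ∀ w z : SpaceX j T, opDt w (embY z) + opDt z (embY w)
      = ⟪γT w, γT z⟫ - ⟪γ₀ w, γ₀ z⟫) (w : SpaceX j T) :
    a.benForm β F γ₀ γT w w ≤ a.energyForm β γ₀ w w := by
  rw [benForm_apply, a.energyForm_self_eq β hibp, real_inner_self_eq_norm_sq,
    real_inner_self_eq_norm_sq]
  have h : a.opC w ((a.opAsOn F).inverse (restrictDual F (a.opC w)) : SpaceY V T)
    ≤ a.opC w (a.opAs.inverse (a.opC w)) :=
    a.isSymmCoercive_opAs.restrict_inverse_le (F := F) (a.opC w)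
  linarith

omit [CompleteSpace V] in
theorem benForm_nonneg (hβ : 1 ≤ β) (F : Submodule ℝ (SpaceY V T)) [CompleteSpace F]
    (w : SpaceX j T) : 0 ≤ a.benForm β F γ₀ γT w w := by
  rw [benForm_apply, real_inner_self_eq_norm_sq, real_inner_self_eq_norm_sq]
  have h1 : 0 ≤ a.opC w ((a.opAsOn F).inverse (restrictDual F (a.opC w)) : SpaceY V T) :=
    (a.isSymmCoercive_opAsOn F).inverse_nonneg (restrictDual F (a.opC w))
  have h2 := a.isSymmCoercive_opAs.nonneg (embY w)
  have h3 : 0 ≤ β - 1 := by linarith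
  positivity

/-- On the trial space, the inf-sup condition for `C` makes the form of the
Brézis-Ekeland-Nayroles system equivalent to the energy inner product. -/
theorem gammaC_sq_mul_energyForm_le (hβ : 1 ≤ β) (hγ : 0 < a.gammaC Xd Yd) (δ : Δ)
    [CompleteSpace (Yd δ)]
    (hibp : ∀ w z : SpaceX j T, opDt w (embY z) + opDt z (embY w)
      = ⟪γT w, γT z⟫ - ⟪γ₀ w, γ₀ z⟫) {w : SpaceX j T} (hw : w ∈ Xd δ) :
    a.gammaC Xd Yd ^ 2 * a.energyForm β γ₀ w w ≤ a.benForm β (Yd δ) γ₀ γT w w := by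
  rw [benForm_apply, a.energyForm_self_eq β hibp, real_inner_self_eq_norm_sq,
    real_inner_self_eq_norm_sq]
  have h : _ ≤ a.opC w ((a.opAsOn (Yd δ)).inverse (restrictDual (Yd δ) (a.opC w)) : SpaceY V T) :=
    a.gammaC_sq_mul_le hγ δ hw
  have h1 : a.gammaC Xd Yd ^ 2 ≤ 1 := pow_le_one₀ hγ.le (a.gammaC_le_one Xd Yd)
  have h2 := a.isSymmCoercive_opAs.nonneg (embY w)
  have h3 : 0 ≤ β - 1 := by linarith
  have h4 : 0 ≤ a.opAs (embY w) (embY w) + ‖γT w‖ ^ 2 + (β - 1) * ‖γ₀ w‖ ^ 2 := by positivity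
  have h5 := mul_le_mul_of_nonneg_right h1 h4
  linarith

omit [CompleteSpace V] in
/-- If `w` lies in the test space, the discrete dual norm of the residual `B w` is determined by
that of `C w` in the same way as for the full dual norm. -/
theorem opB_inverse_self_eq (F : Submodule ℝ (SpaceY V T)) [CompleteSpace F]
    (hibp : ∀ w z : SpaceX j T, opDt w (embY z) + opDt z (embY w)
      = ⟪γT w, γT z⟫ - ⟪γ₀ w, γ₀ z⟫) {w : SpaceX j T} (hw : embY w ∈ F) :
    restrictDual F (a.opB w) ((a.opAsOn F).inverse (restrictDual F (a.opB w)))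
        + β * ⟪γ₀ w, γ₀ w⟫ = a.benForm β F γ₀ γT w w := by
  have h : restrictDual F (a.opB w)
      = restrictDual F (a.opC w) + a.opAsOn F ⟨embY w, hw⟩ := by
    rw [opB_eq]; rfl
  have h1 : restrictDual F (a.opC w) ((a.opAsOn F).inverse (restrictDual F (a.opC w)))
    = a.opC w ((a.opAsOn F).inverse (restrictDual F (a.opC w)) : SpaceY V T) := rfl
  have h2 : restrictDual F (a.opC w) ⟨embY w, hw⟩ = a.opC w (embY w) := rfl
  have h3 : a.opAsOn F ⟨embY w, hw⟩ ⟨embY w, hw⟩ = a.opAs (embY w) (embY w) := rfl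
  rw [h, (a.isSymmCoercive_opAsOn F).inverse_add, h1, h2, h3, a.two_mul_opC_self hibp,
    benForm_apply, real_inner_self_eq_norm_sq, real_inner_self_eq_norm_sq]
  ring

/-- The energy inner product is coercive on `X`. -/
theorem coercive_energyForm (hβ : 1 ≤ β)
    (hibp : ∀ w z : SpaceX j T, opDt w (embY z) + opDt z (embY w)
      = ⟪γT w, γT z⟫ - ⟪γ₀ w, γ₀ z⟫) :
    ∃ c : ℝ, 0 < c ∧ ∀ w : SpaceX j T, c * ‖w‖ ^ 2 ≤ a.energyForm β γ₀ w w := by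
  obtain ⟨c, hc, h⟩ := a.exists_coercive_energy (j := j) norm_weakDt_le
  refine ⟨c, hc, fun w => ?_⟩
  rw [a.energyForm_self_eq β hibp]
  have h3 : 0 ≤ β - 1 := by linarith
  have h4 : 0 ≤ ‖γT w‖ ^ 2 + (β - 1) * ‖γ₀ w‖ ^ 2 := by positivity
  linarith [h w]

/-- Well-posedness and quasi-optimality of the minimal residual method. -/
theorem mr_quasi_optimal [CompleteSpace (SpaceX j T)] (hβ : 1 ≤ β) (hγ : 0 < a.gammaC Xd Yd)
    (δ : Δ) [CompleteSpace (Yd δ)] (hX : IsClosed (Xd δ : Set (SpaceX j T)))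
    (hibp : ∀ w z : SpaceX j T, opDt w (embY z) + opDt z (embY w)
      = ⟪γT w, γT z⟫ - ⟪γ₀ w, γ₀ z⟫)
    (hXY : ∀ w ∈ Xd δ, embY w ∈ Yd δ) (K : StrongDual ℝ (Yd δ) ≃L[ℝ] Yd δ)
    (hK : ∀ f h : StrongDual ℝ (Yd δ), f (K h) = h (K f)) {r R : ℝ} (hr : 0 < r)
    (hKr : ∀ v, r * a.opAsOn (Yd δ) v v ≤ K.symm v v)
    (hKR : ∀ v, K.symm v v ≤ R * a.opAsOn (Yd δ) v v) (u : SpaceX j T) :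
    (∃! x, x ∈ Xd δ ∧ ∀ z ∈ Xd δ,
      a.mrForm β (Yd δ) K γ₀ x z = a.mrForm β (Yd δ) K γ₀ u z) ∧
    ∀ x ∈ Xd δ, (∀ z ∈ Xd δ, a.mrForm β (Yd δ) K γ₀ x z = a.mrForm β (Yd δ) K γ₀ u z) →
      ∀ w ∈ Xd δ, √(a.energyForm β γ₀ (u - x) (u - x))
        ≤ √(max R 1 / min r 1) * (a.gammaC Xd Yd)⁻¹ * √(a.energyForm β γ₀ (u - w) (u - w)) := by
  have hρ0 : 0 < min r 1 := lt_min hr one_pos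
  have hP1 : 1 ≤ max R 1 := le_max_right _ _
  have hβ0 : 0 ≤ β := by linarith
  have hcmp := fun w : SpaceX j T => (a.isSymmCoercive_opAsOn (Yd δ)).compare_inverse K hK hr
    hKr hKR (restrictDual (Yd δ) (a.opB w))
  have hm : ∀ w z, a.mrForm β (Yd δ) K γ₀ w z
      = restrictDual (Yd δ) (a.opB z) (K (restrictDual (Yd δ) (a.opB w))) + β * ⟪γ₀ w, γ₀ z⟫ :=
    fun w z => rfl
  have hms : ∀ w z, a.mrForm β (Yd δ) K γ₀ w z = a.mrForm β (Yd δ) K γ₀ z w := fun w z => by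
    rw [hm, hm, hK, real_inner_comm]
  have hin : ∀ w, 0 ≤ β * ⟪γ₀ w, γ₀ w⟫ := fun w => mul_nonneg hβ0 real_inner_self_nonneg
  have hm0 : ∀ w, 0 ≤ a.mrForm β (Yd δ) K γ₀ w w := fun w => by
    rw [hm]
    exact add_nonneg (hcmp w).1 (hin w)
  have hup : ∀ w, min r 1 * a.mrForm β (Yd δ) K γ₀ w w ≤ a.energyForm β γ₀ w w := by
    intro w
    obtain ⟨h0, h1, -⟩ := hcmp w
    have h2 : restrictDual (Yd δ) (a.opB w)
          ((a.opAsOn (Yd δ)).inverse (restrictDual (Yd δ) (a.opB w)))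
        ≤ a.opB w (a.opAs.inverse (a.opB w)) :=
      a.isSymmCoercive_opAs.restrict_inverse_le (F := Yd δ) (a.opB w)
    have h3 := mul_le_mul_of_nonneg_right (min_le_left r 1) h0
    have h4 := mul_le_mul_of_nonneg_right (min_le_right r 1) (hin w)
    rw [hm, energyForm_apply, mul_add]
    linarith
  have hlow : ∀ w ∈ Xd δ, a.gammaC Xd Yd ^ 2 * a.energyForm β γ₀ w w
      ≤ max R 1 * a.mrForm β (Yd δ) K γ₀ w w := by
    intro w hw
    obtain ⟨h0, -, h1⟩ := hcmp w
    have h2 := a.gammaC_sq_mul_energyForm_le hβ hγ δ hibp hw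
    rw [← a.opB_inverse_self_eq (Yd δ) hibp (hXY w hw)] at h2
    have h3 := mul_le_mul_of_nonneg_right (le_max_left R 1) h0
    have h4 := mul_le_mul_of_nonneg_right hP1 (hin w)
    rw [hm, mul_add]
    linarith
  obtain ⟨c, hc, hcs⟩ := a.coercive_energyForm hβ hibp
  refine ⟨existsUnique_galerkin (a.mrForm β (Yd δ) K γ₀) hms hX
    (c := a.gammaC Xd Yd ^ 2 * c / max R 1) (by positivity) (fun z hz => ?_)
    (a.mrForm β (Yd δ) K γ₀ u), fun x hx hxz w hw => ?_⟩
  · have h1 := hlow z hz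
    have h2 := mul_le_mul_of_nonneg_left (hcs z) (sq_nonneg (a.gammaC Xd Yd))
    rw [div_mul_eq_mul_div, div_le_iff₀ (by positivity)]
    linarith
  · refine galerkin_error_le_of_equivalent (a.energyForm β γ₀).toBilin
      (a.mrForm β (Yd δ) K γ₀).toBilin (a.energyForm_symm β γ₀) hms hm0 hρ0
      ((min_le_right r 1).trans hP1) hγ (a.gammaC_le_one Xd Yd) hup hlow hx hw fun z hz => ?_
    simp only [ContinuousLinearMap.toBilin_apply, map_sub (a.mrForm β (Yd δ) K γ₀), sub_apply,
      hxz z hz, sub_self]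

/-- The energy norm dominates the dual norm of `C q`. -/
theorem opC_apply_le (hβ : 1 ≤ β)
    (hibp : ∀ w z : SpaceX j T, opDt w (embY z) + opDt z (embY w)
      = ⟪γT w, γT z⟫ - ⟪γ₀ w, γ₀ z⟫) (q : SpaceX j T) (d : SpaceY V T) :
    a.opC q d ≤ √(a.energyForm β γ₀ q q) * a.normY d := by
  have hs := a.isSymmCoercive_opAs
  have hs0 := a.energyForm_nonneg (show 0 ≤ β by linarith) γ₀ q
  have hCs : a.opC q (a.opAs.inverse (a.opC q)) ≤ a.energyForm β γ₀ q q := by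
    have h3 := hs.nonneg (embY q)
    have h4 : 0 ≤ β - 1 := by linarith
    have h5 : 0 ≤ ‖γT q‖ ^ 2 + (β - 1) * ‖γ₀ q‖ ^ 2 := by positivity
    rw [a.energyForm_self_eq β hibp q]
    linarith
  have hn : 0 ≤ a.normY d := Real.sqrt_nonneg _
  refine (le_abs_self _).trans (abs_le_of_sq_le_sq ?_ (by positivity))
  rw [mul_pow, Real.sq_sqrt hs0, a.normY_sq]
  exact (hs.sq_apply_le_inverse_mul _ d).trans (mul_le_mul_of_nonneg_right hCs (hs.nonneg d))

/-- Well-posedness and quasi-optimality of the Brézis-Ekeland-Nayroles method. The load deviates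
from `b(u, ·)` by `(C ·)(d)`, where `d` is the error of the energy projection of `u` onto the
test space. -/
theorem ben_quasi_optimal [CompleteSpace (SpaceX j T)] (hβ : 1 ≤ β) (hγ : 0 < a.gammaC Xd Yd)
    (δ : Δ) [CompleteSpace (Yd δ)] (hX : IsClosed (Xd δ : Set (SpaceX j T)))
    (hibp : ∀ w z : SpaceX j T, opDt w (embY z) + opDt z (embY w)
      = ⟪γT w, γT z⟫ - ⟪γ₀ w, γ₀ z⟫) (u : SpaceX j T) (d : SpaceY V T)
    (ℓ : StrongDual ℝ (SpaceX j T))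
    (hℓ : ∀ z, ℓ z = a.benForm β (Yd δ) γ₀ γT u z - a.opC z d) :
    (∃! x, x ∈ Xd δ ∧ ∀ z ∈ Xd δ, a.benForm β (Yd δ) γ₀ γT x z = ℓ z) ∧
    ∀ x ∈ Xd δ, (∀ z ∈ Xd δ, a.benForm β (Yd δ) γ₀ γT x z = ℓ z) →
      ∀ w ∈ Xd δ, √(a.energyForm β γ₀ (u - x) (u - x))
        ≤ ((a.gammaC Xd Yd)⁻¹) ^ 2 * (√(a.energyForm β γ₀ (u - w) (u - w)) + a.normY d) := by
  have hlow : ∀ z ∈ Xd δ, a.gammaC Xd Yd ^ 2 * a.energyForm β γ₀ z z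
      ≤ a.benForm β (Yd δ) γ₀ γT z z := fun z hz =>
    a.gammaC_sq_mul_energyForm_le hβ hγ δ hibp hz
  obtain ⟨c, hc, hcs⟩ := a.coercive_energyForm hβ hibp
  have hsolve := existsUnique_galerkin (a.benForm β (Yd δ) γ₀ γT) (a.benForm_symm (Yd δ)) hX
    (c := a.gammaC Xd Yd ^ 2 * c) (by positivity) (fun z hz => by
      have h1 := hlow z hz
      have h2 := mul_le_mul_of_nonneg_left (hcs z) (sq_nonneg (a.gammaC Xd Yd))
      linarith)
  refine ⟨hsolve ℓ, fun x hx hxz w hw => ?_⟩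
  -- Split the error at the Galerkin approximation `y` for the consistent load `b(u, ·)`.
  obtain ⟨y, ⟨hy, hyz⟩, -⟩ := hsolve (a.benForm β (Yd δ) γ₀ γT u)
  have hbq : a.benForm β (Yd δ) γ₀ γT (y - x) (y - x) = a.opC (y - x) d := by
    have hq : y - x ∈ Xd δ := (Xd δ).sub_mem hy hx
    rw [map_sub (a.benForm β (Yd δ) γ₀ γT), sub_apply, hyz _ hq, hxz _ hq, hℓ]
    ring
  refine galerkin_error_le_of_consistency (a.energyForm β γ₀).toBilin
    (a.benForm β (Yd δ) γ₀ γT).toBilin (a.energyForm_symm β γ₀) (a.benForm_symm (Yd δ))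
    (a.benForm_nonneg hβ (Yd δ)) (a.benForm_le_energyForm (Yd δ) hibp) hγ
    (a.gammaC_le_one Xd Yd) hlow (u := u) hy hx hw (fun z hz => ?_)
    (Real.sqrt_nonneg _) (hbq.le.trans ?_)
  · simp only [ContinuousLinearMap.toBilin_apply, map_sub (a.benForm β (Yd δ) γ₀ γT), sub_apply,
      hyz z hz, sub_self]
  · exact a.opC_apply_le hβ hibp _ d

omit [CompleteSpace V] in
/-- Consistency of the load of the Brézis-Ekeland-Nayroles system, up to the projection error. -/
theorem ben_load_eq (F : Submodule ℝ (SpaceY V T)) [CompleteSpace F]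
    (hibp : ∀ w z : SpaceX j T, opDt w (embY z) + opDt z (embY w)
      = ⟪γT w, γT z⟫ - ⟪γ₀ w, γ₀ z⟫) (u z : SpaceX j T) :
    a.opC z ((a.opAsOn F).inverse (restrictDual F (a.opB u)) : SpaceY V T)
        + a.opB u (embY z) + β * ⟪γ₀ u, γ₀ z⟫
      = a.benForm β F γ₀ γT u z
        - a.opC z (embY u
          - ((a.opAsOn F).inverse (restrictDual F (a.opAs (embY u))) : SpaceY V T)) := by
  have h1 : restrictDual F (a.opB u)
      = restrictDual F (a.opC u) + restrictDual F (a.opAs (embY u)) := by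
    rw [opB_eq]; rfl
  have h2 : a.opB u (embY z) = opDt u (embY z) + a.opAa (embY u) (embY z)
      + a.opAs (embY u) (embY z) := by
    rw [opB_eq]; rfl
  have h3 : a.opC z (embY u) = opDt z (embY u) + a.opAa (embY z) (embY u) := rfl
  have h4 : a.opAa (embY z) (embY u) = -a.opAa (embY u) (embY z) := by
    rw [opAa_apply, opAa_apply]; ring
  have h5 := hibp u z
  rw [benForm_apply, h1, map_add, Submodule.coe_add, map_add, map_sub, h2, h3, h4]
  linarith

omit [CompleteSpace V] in
/-- The `A_s`-orthogonal projection onto `F` is the best approximation in the energy norm. -/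
theorem normY_sub_projection_le (F : Submodule ℝ (SpaceY V T)) [CompleteSpace F]
    (y : SpaceY V T) (v : F) :
    a.normY (y - ((a.opAsOn F).inverse (restrictDual F (a.opAs y)) : SpaceY V T))
      ≤ a.normY (y - v) := by
  have hs := a.isSymmCoercive_opAs
  set p := (a.opAsOn F).inverse (restrictDual F (a.opAs y))
  have hp : ∀ z : F, a.opAs (p : SpaceY V T) z = a.opAs y z := fun z => by
    have h := (a.isSymmCoercive_opAsOn F).apply_inverse (restrictDual F (a.opAs y))
    exact congrArg (fun f => f z) h
  refine Real.sqrt_le_sqrt ?_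
  have h1 : a.opAs (y - p) ((p - v : F) : SpaceY V T) = 0 := by
    rw [map_sub, sub_apply, hp, sub_self]
  have h2 : y - (v : SpaceY V T) = (y - p) + ((p - v : F) : SpaceY V T) := by
    rw [Submodule.coe_sub]; abel
  rw [h2]
  generalize y - (p : SpaceY V T) = e at h1 ⊢
  generalize ((p - v : F) : SpaceY V T) = x at h1 ⊢
  simp only [map_add, add_apply, hs.symm x e, h1]
  linarith [hs.nonneg x]

end ParabolicForm

end Galerkin

end

/-! ### The error bounds -/

theorem mainTheorem2
    {V H : Type*}
    [NormedAddCommGroup V] [InnerProductSpace ℝ V] [CompleteSpace V]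
    [TopologicalSpace.SeparableSpace V]
    [NormedAddCommGroup H] [InnerProductSpace ℝ H] [CompleteSpace H]
    [TopologicalSpace.SeparableSpace H]
    (j : V →L[ℝ] H) (hj_inj : Function.Injective j) (hj_dense : DenseRange j)
    (T : ℝ) (hT : 0 < T) (a : ParabolicForm V T) (β : ℝ) (hβ : 1 ≤ β)
    {Δ : Type*} (Xd : Δ → Submodule ℝ (SpaceX j T)) (Yd : Δ → Submodule ℝ (SpaceY V T))
    (hXd_closed : ∀ δ, IsClosed (Xd δ : Set (SpaceX j T))) (hXd_ne : ∀ δ, Xd δ ≠ ⊥)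
    (hYd_closed : ∀ δ, IsClosed (Yd δ : Set (SpaceY V T))) (hYd_ne : ∀ δ, Yd δ ≠ ⊥)
    (hγ : 0 < a.gammaC Xd Yd)
    (g : StrongDual ℝ (SpaceY V T)) (u₀ : H)
    (u : SpaceX j T) (hu : a.opB u = g) (hu₀ : trace 0 u = u₀) :
    (∀ (K : ∀ δ, StrongDual ℝ (Yd δ) ≃L[ℝ] Yd δ) (r R : ℝ),
      (∀ δ, ∀ w ∈ Xd δ, embY w ∈ Yd δ) →
      (∀ δ (f h : StrongDual ℝ (Yd δ)), f (K δ h) = h (K δ f)) →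
      0 < r → r ≤ R →
      (∀ δ (v : Yd δ), v ≠ 0 →
        (K δ).symm v v / a.opAs (v : SpaceY V T) (v : SpaceY V T) ∈ Set.Icc r R) →
      ∀ δ, (∃! uδ : SpaceX j T, a.IsMRSolution β (Xd δ) (Yd δ) (K δ) g u₀ uδ) ∧
        ∀ uδ : SpaceX j T, a.IsMRSolution β (Xd δ) (Yd δ) (K δ) g u₀ uδ →
          a.energyNormX β (u - uδ) ≤
            √(max R 1 / min r 1) * (a.gammaC Xd Yd)⁻¹ *
              ⨅ w : Xd δ, a.energyNormX β (u - (w : SpaceX j T))) ∧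
    (∀ δ, (∃! uδ : SpaceX j T, a.IsBENSolution β (Xd δ) (Yd δ) g u₀ uδ) ∧
      ∀ uδ : SpaceX j T, a.IsBENSolution β (Xd δ) (Yd δ) g u₀ uδ →
        a.energyNormX β (u - uδ) ≤
          ((a.gammaC Xd Yd)⁻¹) ^ 2 *
            ((⨅ w : Xd δ, a.energyNormX β (u - (w : SpaceX j T))) +
              ⨅ v : Yd δ, a.normY (embY u - (v : SpaceY V T)))) := by
  have : CompleteSpace (SpaceX j T) := completeSpace_spaceX j T
  have hYc : ∀ δ, CompleteSpace (Yd δ) := fun δ => (hYd_closed δ).completeSpace_coe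
  have hT0 : (0 : ℝ) ∈ Icc 0 T := ⟨le_rfl, hT.le⟩
  have hTT : T ∈ Icc 0 T := ⟨hT.le, le_rfl⟩
  obtain ⟨γ₀, h0⟩ := exists_trace_clm hj_inj hT hT0
  obtain ⟨γT, h1⟩ := exists_trace_clm hj_inj hT hTT
  have hibp : ∀ w z : SpaceX j T, opDt w (embY z) + opDt z (embY w)
      = ⟪γT w, γT z⟫ - ⟪γ₀ w, γ₀ z⟫ := fun w z => by
    rw [h0, h0, h1, h1, opDt_add_opDt hj_inj hT]
  simp only [a.energyNormX_eq β h0]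
  refine ⟨fun K r R hXY hK hr hrR hKr δ => ?_, fun δ => ?_⟩
  · have hKv : ∀ v : Yd δ, r * a.opAsOn (Yd δ) v v ≤ (K δ).symm v v ∧
        (K δ).symm v v ≤ R * a.opAsOn (Yd δ) v v := fun v => by
      rcases eq_or_ne v 0 with rfl | hv
      · simp
      · obtain ⟨c, hc, hcv⟩ := (a.isSymmCoercive_opAsOn (Yd δ)).coercive
        have hpos : 0 < a.opAsOn (Yd δ) v v :=
          lt_of_lt_of_le (mul_pos hc (pow_pos (norm_pos_iff.2 hv) 2)) (hcv v)
        have h := hKr δ v hv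
        exact ⟨(le_div_iff₀ hpos).1 h.1, (div_le_iff₀ hpos).1 h.2⟩
    have hiff : ∀ x, a.IsMRSolution β (Xd δ) (Yd δ) (K δ) g u₀ x ↔ x ∈ Xd δ ∧ ∀ z ∈ Xd δ,
        a.mrForm β (Yd δ) (K δ) γ₀ x z = a.mrForm β (Yd δ) (K δ) γ₀ u z := fun x => by
      simp only [ParabolicForm.IsMRSolution, ParabolicForm.mrForm_apply, h0, hu, hu₀]
      rfl
    obtain ⟨hex, hest⟩ := a.mr_quasi_optimal hβ hγ δ (hXd_closed δ) hibp (hXY δ) (K δ) (hK δ) hr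
      (fun v => (hKv v).1) (fun v => (hKv v).2) u
    simp only [hiff]
    refine ⟨hex, fun x hx => ?_⟩
    rw [Real.mul_iInf_of_nonneg (by positivity)]
    exact le_ciInf fun w => hest x hx.1 hx.2 w w.2
  · set d := embY u
      - ((a.opAsOn (Yd δ)).inverse (restrictDual (Yd δ) (a.opAs (embY u))) : SpaceY V T)
    set ℓ : StrongDual ℝ (SpaceX j T) :=
      a.benForm β (Yd δ) γ₀ γT u - (ContinuousLinearMap.apply ℝ ℝ d).comp a.opC
    have hℓ : ∀ z, ℓ z = a.benForm β (Yd δ) γ₀ γT u z - a.opC z d := fun z => rfl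
    have hiff : ∀ x, a.IsBENSolution β (Xd δ) (Yd δ) g u₀ x ↔ x ∈ Xd δ ∧ ∀ z ∈ Xd δ,
        a.benForm β (Yd δ) γ₀ γT x z = ℓ z := fun x => by
      have hload : ∀ z, a.opC z ((a.opAsOn (Yd δ)).inverse (restrictDual (Yd δ) (a.opB u)) :
          SpaceY V T) + a.opB u (embY z) + β * ⟪γ₀ u, γ₀ z⟫ = ℓ z := fun z =>
        a.ben_load_eq (Yd δ) hibp u z
      refine and_congr_right fun _ => forall₂_congr fun z _ => ?_
      rw [← hload, ParabolicForm.benForm_apply, hu, h0, h0, h0, h1, h1, hu₀]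
    obtain ⟨hex, hest⟩ := a.ben_quasi_optimal hβ hγ δ (hXd_closed δ) hibp u d ℓ hℓ
    simp only [hiff]
    refine ⟨hex, fun x hx => ?_⟩
    have hd : a.normY d ≤ ⨅ v : Yd δ, a.normY (embY u - (v : SpaceY V T)) :=
      le_ciInf fun v => a.normY_sub_projection_le (Yd δ) (embY u) v
    refine le_trans ?_ (mul_le_mul_of_nonneg_left (add_le_add_right hd _) (sq_nonneg _))
    rw [← inv_mul_le_iff₀ (by positivity), ← sub_le_iff_le_add]
    refine le_ciInf fun w => ?_
    rw [sub_le_iff_le_add, inv_mul_le_iff₀ (by positivity)]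
    exact hest x hx.1 hx.2 w w.2
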